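/- Let $\Omega\subset\mathbb R^3$ be a bounded open set with $\Omega=\operatorname{int}\overline\Omega$ (for example a bounded Lipschitz domain), and let $\mathcal T$ be a finite simplicial complex whose underlying space is $\overline\Omega$. A *primal cell* is a (closed) tetrahedron $T$ of $\mathcal T$. For a primal cell $T$ and a vertex $N$ of $T$ let $K=K(T,N)$ be the hexahedron whose eight vertices are the barycentres of the faces (of dimension $0,1,2,3$) of $T$ that contain $N$; let $\mathcal K$ be the set of all these hexahedra. The *dual cell* of a node $N$ is $\widetilde T_N=\bigcup_{T\ni N}K(T,N)$, so that $K(T,N)=T\cap\widetilde T_N$. For each $K=K(T,N)$ number the other three vertices of $T$ as $v_1,v_2,v_3$ (arbitrarily), and let $\mathbf F_K:\widehat K=[-1,1]^3\to K$ be the trilinear map that sends the cube vertex with coordinates $+1$ on the axes $i\in\sigma$ and $-1$ on the others to the barycentre of $\{N\}\cup\{v_i:i\in\sigma\}$, for every $\sigma\subseteq\{1,2,3\}$. Let $\mathbf J_K$ be its Jacobian matrix; a reference field $\widehat{\boldsymbol v}$ on $\widehat K$ is mapped to $K$ by the covariant Piola transform $\boldsymbol v\circ\mathbf F_K=\mathbf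 J_K^{-T}\widehat{\boldsymbol v}$. Let $P\ge1$, let $-1=\xi_0<\dots<\xi_P<1$ be the Gauss–Radau points of $[-1,1]$ (the quadrature rule on them, with suitable weights, is exact for polynomials of degree at most $2P$), let $\ell_0,\dots,\ell_P$ be the Lagrange interpolation polynomials on these points, and put $\ell_\alpha(\hat x)=\ell_{\alpha_1}(\hat x_1)\ell_{\alpha_2}(\hat x_2)\ell_{\alpha_3}(\hat x_3)$ for $\alpha\in\{0,\dots,P\}^3$. *Basis on the dual mesh.* A function $\boldsymbol E_n$ is given by a node $N$, a simplex $F$ of $\mathcal T$ with $N\in F$ (a tetrahedron, triangle or edge: cell-, face- or edge-centred function), a vertex $w\ne N$ of $F$, and degrees $a_v\in\{0,\dots,P\}$ for the vertices $v\neq N$ of $F$, with $a_v\neq0$ for $v\ne w$. On each $K(T,N)$ with $F\subseteq T$ it is the Piola transform of $\ell_\alpha(\hat{\mathbf x})\,\hat{\mathbf e}_i$, where $v_i=w$, and $\alpha_j=a_{v_j}$ if $v_j\in F$ and $\alpha_j=0$ otherwise; on all other hexahedra it is $0$. *Basis on the primal mesh.* A function $\boldsymbol H_{\tilde n}$ is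 given by a tetrahedron $T$, a nonempty set $M$ of vertices of $T$, a vertex $w\notin M$ of $T$, and degrees $a_v\in\{0,\dots,P\}$ for the vertices $v\notin M$ of $T$, with $a_v\ne0$ for $v\neq w$ (cell-, face- and edge-centred for $|M|=1,2,3$). On each $K(T,N)$ with $N\in M$ it is the Piola transform of $\ell_\alpha(-\hat{\mathbf x})\,\hat{\mathbf e}_i$, where $v_i=w$, and $\alpha_j=a_{v_j}$ if $v_j\notin M$ and $\alpha_j=0$ otherwise; on all other hexahedra it is $0$. With $\mathbf n$ the outward unit normal to $\partial K$, with one-sided traces from $K$ in the boundary terms, and for $K=K(T,N)$ with $$\partial K_{\mathcal T}=\partial K\cap\partial T,\qquad \partial K_{\widetilde{\mathcal T}}=(\partial K\cap\partial\widetilde T_N)\setminus\partial\Omega ,$$ define $$\widetilde c_{n\tilde n}=\sum_{K\in\mathcal K}\Big(-\int_{\partial K_{\widetilde{\mathcal T}}}\boldsymbol E_n\times\boldsymbol H_{\tilde n}\cdot\mathbf n\,dS+\int_K\operatorname{curl}\boldsymbol E_n\cdot\boldsymbol H_{\tilde n}\,dV\Big),$$ $$c_{\tilde nn}=\sum_{K\in\mathcal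 K}\Big(-\int_{\partial K_{\mathcal T}}\boldsymbol H_{\tilde n}\times\boldsymbol E_n\cdot\mathbf n\,dS+\int_K\operatorname{curl}\boldsymbol H_{\tilde n}\cdot\boldsymbol E_n\,dV\Big).$$ Then all these integrals converge, and: 1. $\widetilde c_{n\tilde n}=c_{\tilde nn}$ for all $n,\tilde n$, that is, $\widetilde{\mathbf C}=\mathbf C^{T}$. 2. Each $\boldsymbol E_n$ is supported in the single dual cell $\widetilde T_N$ of its node, and each $\boldsymbol H_{\tilde n}$ in the single primal cell $T$ of its tetrahedron. 3. $\mathbf C$ is sparse: $c_{\tilde nn}=0$ whenever the primal cell of $\tilde n$ and the dual cell of $n$ are disjoint. Each row of $\mathbf C$ has at most $12(P+1)^3$ nonzero entries, and the column of $n$ has at most $3(P+1)^3$ times the number of tetrahedra at the node of $n$. -/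

import Mathlib

open MeasureTheory Set
open scoped Matrix Polynomial

namespace DualCell

noncomputable section

/-- Points and vectors of `ℝ³`, in coordinates. -/
abbrev R3 : Type := Fin 3 → ℝ

/-- The classical curl of a vector field on `ℝ³`. -/
def curl (v : R3 → R3) (x : R3) : R3 :=
  let D : Fin 3 → Fin 3 → ℝ := fun j i => fderiv ℝ v x (Pi.single j 1) i
  ![D 1 2 - D 2 1, D 2 0 - D 0 2, D 0 1 - D 1 0]

/-- The reference cube `[-1, 1]³`. -/
def refCube : Set R3 := Icc (-1) 1

/-! ### Gauss-Radau interpolation -/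

/-- `ξ 0 < ⋯ < ξ P` are the `P + 1` Gauss-Radau quadrature points of `[-1, 1]` that include the
left end point: the quadrature rule on these points (with suitable weights) is exact for all
polynomials of degree at most `2 P`. -/
structure IsGaussRadau (P : ℕ) (ξ : Fin (P + 1) → ℝ) : Prop where
  strictMono : StrictMono ξ
  left : ξ 0 = -1
  lt_one : ∀ a, ξ a < 1
  exact : ∃ w : Fin (P + 1) → ℝ, ∀ p : ℝ[X], p.natDegree ≤ 2 * P →
    ∫ x in (-1 : ℝ)..1, p.eval x = ∑ a, w a * p.eval (ξ a)

/-- The tensor-product interpolation polynomial `ℓ_α(x) = ℓ_{α₀}(x₀) ℓ_{α₁}(x₁) ℓ_{α₂}(x₂)`. -/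
def ell {P : ℕ} (ξ : Fin (P + 1) → ℝ) (α : Fin 3 → Fin (P + 1)) (x : R3) : ℝ :=
  ∏ j, (Lagrange.basis Finset.univ ξ (α j)).eval (x j)

/-! ### The primal mesh, its barycentric dual, and the hexahedral subcells -/

/-- The barycentre of a finite set of points. -/
def bary (s : Finset R3) : R3 := (s.card : ℝ)⁻¹ • ∑ v ∈ s, v

/-- A pair (tetrahedron `T` of the mesh, vertex `N` of `T`). These pairs index the hexahedra
`K = T ∩ T̃`, with `T` a primal cell and `T̃` the dual cell of `N`; this intersection is
empty when `N` is not a vertex of `T`. -/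
structure Subcell (S : Geometry.SimplicialComplex ℝ R3) where
  cell : Finset R3
  cell_mem : cell ∈ S.faces
  cell_card : cell.card = 4
  node : R3
  node_mem : node ∈ cell

variable {S : Geometry.SimplicialComplex ℝ R3}

instance [Finite S.faces] : Finite (Subcell S) :=
  Finite.of_injective
    (β := Σ s : S.faces, {v : R3 // v ∈ s.1})
    (fun K => ⟨⟨K.cell, K.cell_mem⟩, ⟨K.node, K.node_mem⟩⟩) (by
      rintro ⟨T, hT, hc, N, hN⟩ ⟨T', hT', hc', N', hN'⟩ h
      simp only [Sigma.mk.injEq, Subtype.mk.injEq] at h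
      obtain ⟨rfl, h⟩ := h
      simp only [heq_eq_eq, Subtype.mk.injEq] at h
      subst h
      rfl)

instance [Finite S.faces] : Fintype (Subcell S) := Fintype.ofFinite _

/-- The hexahedron `K`: its eight vertices are the barycentres of the faces of `T` (of dimension
`0, …, 3`) that contain `N`. -/
def Subcell.hex (K : Subcell S) : Set R3 :=
  convexHull ℝ {b | ∃ s : Finset R3, s ⊆ K.cell ∧ K.node ∈ s ∧ b = bary s}

/-- The dual cell of the node `N`: the union of the hexahedra at `N`. -/
def dualCell (S : Geometry.SimplicialComplex ℝ R3) (N : R3) : Set R3 :=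
  ⋃ K ∈ {K : Subcell S | K.node = N}, K.hex

/-- For every hexahedron `K = (T, N)`, a numbering of the three vertices of `T` other than `N`
by the three axes of the reference cube. -/
abbrev AxisLabelling (S : Geometry.SimplicialComplex ℝ R3) : Type :=
  ∀ K : Subcell S, Fin 3 ≃ {v : R3 // v ∈ K.cell ∧ v ≠ K.node}

variable (ν : AxisLabelling S) (K : Subcell S)

open Classical in
/-- The vertex of `K` that corresponds to the vertex of the reference cube with coordinates `1` on
the axes in `σ` and `-1` on the others. In particular `(-1,-1,-1)` corresponds to the node `N` and
`(1,1,1)` to the barycentre of `T`. -/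
def hexVertex (σ : Finset (Fin 3)) : R3 :=
  bary (insert K.node (σ.image fun i => (ν K i : R3)))

/-- The trilinear map `F_K` from the reference cube onto `K`. -/
def trilinear (x : R3) : R3 :=
  ∑ σ : Finset (Fin 3),
    ((∏ i ∈ σ, (1 + x i) / 2) * ∏ i ∈ σᶜ, (1 - x i) / 2) • hexVertex ν K σ

/-- The Jacobian matrix `J_K` of `F_K`. -/
def jac (x : R3) : Matrix (Fin 3) (Fin 3) ℝ :=
  LinearMap.toMatrix' (fderiv ℝ (trilinear ν K) x : R3 →ₗ[ℝ] R3)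

/-- The covariant Piola transform `v = J_K^{-T} v̂` of a field on the reference cube, as a
field on `K`. -/
def piola (vhat : R3 → R3) (x : R3) : R3 :=
  let xhat := Function.invFunOn (trilinear ν K) refCube x
  ((jac ν K xhat)⁻¹)ᵀ *ᵥ vhat xhat

/-! ### The two bases -/

/-- Index set of the basis functions `E_n` on the dual mesh. The function is attached to the node
`N`, to a simplex of the mesh containing `N` (a tetrahedron, triangle or edge: cell-, face- or
edge-centred functions) and to a direction, the axis from `N` to another vertex `dir` of the
simplex. The index of the interpolation node on the axis towards a vertex of the simplex is
`deg`; it is nonzero on all axes but that of `dir`. -/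
structure EIndex (S : Geometry.SimplicialComplex ℝ R3) (P : ℕ) where
  node : R3
  simplex : Finset R3
  simplex_mem : simplex ∈ S.faces
  node_mem : node ∈ simplex
  dir : R3
  dir_mem : dir ∈ simplex
  dir_ne : dir ≠ node
  deg : {v : R3 // v ∈ simplex ∧ v ≠ node} → Fin (P + 1)
  deg_ne : ∀ v, v.1 ≠ dir → deg v ≠ 0

/-- Index set of the basis functions `H_ñ` on the primal mesh. The function is attached to a
tetrahedron `cell`, to a nonempty set `core` of vertices of it (one, two or three: the barycentric
dual, inside the tetrahedron, of the simplex spanned by `core` is a hexahedron, a quadrilateral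
between two hexahedra, or a segment common to three hexahedra: cell-, face- or edge-centred
functions) and to a direction, the axis towards a vertex `dir` outside `core`. The index of
the interpolation node on the axis towards a vertex outside `core` is `deg`; it is nonzero on all
axes but that of `dir`. -/
structure HIndex (S : Geometry.SimplicialComplex ℝ R3) (P : ℕ) where
  cell : Finset R3
  cell_mem : cell ∈ S.faces
  cell_card : cell.card = 4
  core : Finset R3
  core_subset : core ⊆ cell
  core_nonempty : core.Nonempty
  dir : R3
  dir_mem : dir ∈ cell
  dir_notMem : dir ∉ core
  deg : {v : R3 // v ∈ cell ∧ v ∉ core} → Fin (P + 1)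
  deg_ne : ∀ v, v.1 ≠ dir → deg v ≠ 0

variable {P : ℕ} (ξ : Fin (P + 1) → ℝ)

open Classical in
/-- The reference field `Ê_{n,K}`: it is `ℓ_α(x̂) ê_i` on the hexahedra at the node of `n` that lie
in a tetrahedron containing the simplex of `n`, and zero on all others. Here `i` is the axis of `K`
towards `dir`, and `α` is `deg` on the axes of `K` towards vertices of the simplex, `0` on the
others. -/
def EIndex.ref (n : EIndex S P) (x : R3) : R3 :=
  if K.node = n.node ∧ n.simplex ⊆ K.cell then
    fun i => if (ν K i : R3) = n.dir then
      ell ξ (fun j => if h : (ν K j : R3) ∈ n.simplex ∧ (ν K j : R3) ≠ n.node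
        then n.deg ⟨ν K j, h⟩ else 0) x
    else 0
  else 0

open Classical in
/-- The reference field `Ĥ_{ñ,K}`: it is `ℓ_α(-x̂) ê_i` on the hexahedra of the tetrahedron of `ñ`
whose node belongs to `core`, and zero on all others. Here `i` is the axis of `K` towards `dir`, and
`α` is `deg` on the axes of `K` towards vertices outside `core`, `0` on the others. -/
def HIndex.ref (m : HIndex S P) (x : R3) : R3 :=
  if K.cell = m.cell ∧ K.node ∈ m.core then
    fun i => if (ν K i : R3) = m.dir then
      ell ξ (fun j => if h : (ν K j : R3) ∈ m.cell ∧ (ν K j : R3) ∉ m.core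
        then m.deg ⟨ν K j, h⟩ else 0) (-x)
    else 0
  else 0

/-- The restriction of `E_n` to the hexahedron `K`. -/
def EIndex.field (n : EIndex S P) : R3 → R3 := piola ν K (n.ref ν K ξ)

/-- The restriction of `H_ñ` to the hexahedron `K`. -/
def HIndex.field (m : HIndex S P) : R3 → R3 := piola ν K (m.ref ν K ξ)

/-! ### Boundary terms -/

/-- The point of the face `x̂_i = s` of the reference cube with the other two coordinates `y`. -/
def facePoint (i : Fin 3) (s : ℝ) (y : Fin 2 → ℝ) : R3 := i.insertNth s y

/-- The density of `v · n dS` (`n` the outward unit normal to `∂K`, `dS` the area element of `∂K`)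
with respect to area on the face `x̂_i = s` of the reference cube, `s = ± 1`: the vector
`n dS` is `|det J_K| J_K^{-T} n̂`, where `n̂ = s ê_i` is the outward unit normal to the cube. -/
def fluxDensity (v : R3 → R3) (i : Fin 3) (s : ℝ) (y : Fin 2 → ℝ) : ℝ :=
  let xhat := facePoint i s y
  v (trilinear ν K xhat) ⬝ᵥ (|(jac ν K xhat).det| • (((jac ν K xhat)⁻¹)ᵀ *ᵥ Pi.single i s))

/-- The surface integral `∫_{∂K ∩ A} v · n dS`, in the parametrisation of `∂K` by the six faces
of the reference cube. -/
def flux (A : Set R3) (v : R3 → R3) : ℝ :=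
  ∑ i : Fin 3, ∑ s ∈ ({-1, 1} : Finset ℝ),
    ∫ y in {y : Fin 2 → ℝ | y ∈ Icc (-1) 1 ∧ trilinear ν K (facePoint i s y) ∈ A},
      fluxDensity ν K v i s y

/-- The part of `∂K` on the boundary of the primal cell containing `K`. -/
def primalBdry : Set R3 :=
  frontier K.hex ∩ frontier (convexHull ℝ (K.cell : Set R3))

/-- The part of `∂K` on the boundary of the dual cell containing `K`, the boundary of the domain
`Ω` excepted. -/
def dualBdry (Ω : Set R3) : Set R3 :=
  (frontier K.hex ∩ frontier (dualCell S K.node)) \ frontier Ω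

/-! ### The two discrete curl matrices -/

/-- The matrix `C̃`. -/
def curlE [Finite S.faces] (Ω : Set R3) : Matrix (EIndex S P) (HIndex S P) ℝ := fun n m =>
  ∑ K : Subcell S,
    (-flux ν K (dualBdry K Ω) (fun x => n.field ν K ξ x ⨯₃ m.field ν K ξ x)
      + ∫ x in K.hex, curl (n.field ν K ξ) x ⬝ᵥ m.field ν K ξ x)

/-- The matrix `C`. -/
def curlH [Finite S.faces] : Matrix (HIndex S P) (EIndex S P) ℝ := fun m n =>
  ∑ K : Subcell S,
    (-flux ν K (primalBdry K) (fun x => m.field ν K ξ x ⨯₃ n.field ν K ξ x)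
      + ∫ x in K.hex, curl (m.field ν K ξ) x ⬝ᵥ n.field ν K ξ x)

end

end DualCell

/-!
In the barycentric coordinates of `T` at the vertices `vᵢ`, the trilinear map `F_K` of `K(T, N)` is
a polynomial map `hexMap` that is the same for all hexahedra. On the reference cube its Jacobian has
nonpositive off-diagonal entries and positive row sums, a property stable under positive
combinations. Hence `det J_K` has a constant sign, and `F_K` is injective because the difference
quotients of `hexMap` are averages of such Jacobians. The image `K` is the part of `T` where the
coordinate of `N` is the largest one. Its faces `x̂ᵢ = -1`, where the coordinate of `vᵢ` vanishes,
lie in `∂T`, and near their relative interiors `T̃_N` fills `Ω̄`; its faces `x̂ᵢ = 1`, where the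
coordinates of `vᵢ` and `N` agree, lie in `∂T̃_N` and inside `T`.

The covariant Piola transform pulls `curl E · H dV` and `E × H · n dS` back to the same expressions
on the reference cube, up to the sign of `det J_K`. There `div (u × w) = curl u · w - curl w · u`,
and the divergence theorem gives the equality of the two matrices hexahedron by hexahedron. A basis
function that does not vanish on `K` is determined by its direction and its degrees at the three
vertices of `T` other than `N`, so there are at most `3 (P + 1)³` of each kind on one hexahedron;
an entry of the matrix can be nonzero only if the two functions share a hexahedron.
-/

namespace DualCell

noncomputable section

section Matrices

variable {n : Type*} [Fintype n]

/-- Matrices with nonpositive off-diagonal entries and positive row sums. They form a convex cone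
of strictly diagonally dominant matrices that contains the identity. -/
structure RowDominant (A : Matrix n n ℝ) : Prop where
  offDiag_nonpos : ∀ i j, i ≠ j → A i j ≤ 0
  rowSum_pos : ∀ i, 0 < ∑ j, A i j

theorem RowDominant.one [DecidableEq n] : RowDominant (1 : Matrix n n ℝ) where
  offDiag_nonpos i j h := (Matrix.one_apply_ne h).le
  rowSum_pos i := by simp [Matrix.one_apply]

theorem RowDominant.add {A B : Matrix n n ℝ} (hA : RowDominant A) (hB : RowDominant B) :
    RowDominant (A + B) where
  offDiag_nonpos i j h := add_nonpos (hA.offDiag_nonpos i j h) (hB.offDiag_nonpos i j h)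
  rowSum_pos i := by
    simpa only [Matrix.add_apply, Finset.sum_add_distrib]
      using add_pos (hA.rowSum_pos i) (hB.rowSum_pos i)

theorem RowDominant.smul {A : Matrix n n ℝ} (hA : RowDominant A) {c : ℝ} (hc : 0 < c) :
    RowDominant (c • A) where
  offDiag_nonpos i j h := smul_nonpos_of_nonneg_of_nonpos hc.le (hA.offDiag_nonpos i j h)
  rowSum_pos i := by
    simpa only [Matrix.smul_apply, Finset.smul_sum] using smul_pos hc (hA.rowSum_pos i)

theorem RowDominant.det_ne_zero [DecidableEq n] {A : Matrix n n ℝ} (hA : RowDominant A) :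
    A.det ≠ 0 := by
  refine det_ne_zero_of_sum_row_lt_diag fun k => ?_
  have hoff : ∑ j ∈ Finset.univ.erase k, ‖A k j‖ = -∑ j ∈ Finset.univ.erase k, A k j := by
    rw [← Finset.sum_neg_distrib]
    exact Finset.sum_congr rfl fun j hj =>
      Real.norm_of_nonpos (hA.offDiag_nonpos k j (Finset.ne_of_mem_erase hj).symm)
  have hrow := hA.rowSum_pos k
  rw [← Finset.add_sum_erase _ _ (Finset.mem_univ k)] at hrow
  calc ∑ j ∈ Finset.univ.erase k, ‖A k j‖ < A k k := by linarith
    _ ≤ ‖A k k‖ := Real.le_norm_self _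

/-- The determinant does not vanish on the segment from the identity to `A`. -/
theorem RowDominant.det_pos [DecidableEq n] {A : Matrix n n ℝ} (hA : RowDominant A) :
    0 < A.det := by
  by_contra! h
  let f : ℝ → ℝ := fun t => ((1 - t) • (1 : Matrix n n ℝ) + t • A).det
  have hf : Continuous f := by
    refine Continuous.matrix_det ?_
    fun_prop
  have hmem : (0 : ℝ) ∈ Ioo (f 1) (f 0) := by
    simpa [f] using lt_of_le_of_ne h hA.det_ne_zero
  obtain ⟨t, ht, ht0⟩ := intermediate_value_Ioo' zero_le_one hf.continuousOn hmem
  exact ((RowDominant.one.smul (sub_pos.2 ht.2)).add (hA.smul ht.1)).det_ne_zero ht0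

theorem mulVec_dotProduct_transpose_inv_mulVec {R : Type*} [CommRing R] [DecidableEq n]
    {A : Matrix n n R} (hA : IsUnit A.det) (u v : n → R) :
    (A *ᵥ u) ⬝ᵥ ((A⁻¹)ᵀ *ᵥ v) = u ⬝ᵥ v := by
  rw [Matrix.mulVec_transpose, dotProduct_comm, ← Matrix.dotProduct_mulVec, Matrix.mulVec_mulVec,
    Matrix.nonsing_inv_mul _ hA, Matrix.one_mulVec, dotProduct_comm]

variable {E : Type*} [NormedAddCommGroup E] [NormedSpace ℝ E] [DecidableEq n]
  {A : E → Matrix n n ℝ} {x : E}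

theorem differentiableAt_det (hA : ∀ i j, DifferentiableAt ℝ (fun y => A y i j) x) :
    DifferentiableAt ℝ (fun y => (A y).det) x := by
  simp only [Matrix.det_apply]
  fun_prop

theorem differentiableAt_inv_apply (hA : ∀ i j, DifferentiableAt ℝ (fun y => A y i j) x)
    (hdet : (A x).det ≠ 0) (i j : n) : DifferentiableAt ℝ (fun y => (A y)⁻¹ i j) x := by
  have hadj : DifferentiableAt ℝ (fun y => (A y).adjugate i j) x := by
    simp only [Matrix.adjugate_apply]
    refine differentiableAt_det fun k l => ?_
    by_cases hk : k = j
    · simp only [hk, Matrix.updateRow_self]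
      fun_prop
    · simpa only [Matrix.updateRow_ne hk] using hA k l
  simp only [Matrix.inv_def, Ring.inverse_eq_inv, Matrix.smul_apply, smul_eq_mul]
  exact ((differentiableAt_det hA).inv hdet).mul hadj

theorem differentiableAt_transpose_inv_mulVec
    (hA : ∀ i j, DifferentiableAt ℝ (fun y => A y i j) x) (hdet : (A x).det ≠ 0)
    {v : E → n → ℝ} (hv : DifferentiableAt ℝ v x) :
    DifferentiableAt ℝ (fun y => ((A y)⁻¹)ᵀ *ᵥ v y) x := by
  refine differentiableAt_pi.2 fun i => ?_
  simp only [Matrix.mulVec, dotProduct, Matrix.transpose_apply]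
  exact DifferentiableAt.fun_sum fun j _ =>
    (differentiableAt_inv_apply hA hdet j i).mul (differentiableAt_pi.1 hv j)

end Matrices

theorem mem_interior_Icc_pi {ι : Type*} [Finite ι] {a b x : ι → ℝ} :
    x ∈ interior (Icc a b) ↔ ∀ i, a i < x i ∧ x i < b i := by
  simp only [← pi_univ_Icc, interior_pi_set (toFinite _), interior_Icc, mem_univ_pi, mem_Ioo]

theorem interior_ae_eq_of_convex {E : Type*} [NormedAddCommGroup E] [NormedSpace ℝ E]
    [MeasurableSpace E] [BorelSpace E] [FiniteDimensional ℝ E] (μ : Measure E)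
    [μ.IsAddHaarMeasure] {s : Set E} (hs : Convex ℝ s) : interior s =ᵐ[μ] s :=
  interior_ae_eq_of_null_frontier (hs.addHaar_frontier μ)

theorem sum_fin_three_cyclic {M : Type*} [AddCommMonoid M] (f : Fin 3 → M) (i : Fin 3) :
    ∑ j, f j = f i + f (i + 1) + f (i + 2) := by
  rw [← Equiv.sum_comp (Equiv.addLeft i), Fin.sum_univ_three]
  simp only [Equiv.coe_addLeft, add_zero]

/-- The trilinear map of a tetrahedron in barycentric coordinates: `hexMap x i` is the coordinate
of `F_K x` with respect to the vertex on the axis `i`. -/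
def hexMap (x : R3) : R3 := fun i =>
  (1 + x i) * ((3 - x (i + 1)) * (3 - x (i + 2)) + 8) / 96

/-- The Jacobian matrix of `hexMap`. -/
def hexJac (x : R3) : Matrix (Fin 3) (Fin 3) ℝ := Matrix.of fun i j =>
  ![((3 - x (i + 1)) * (3 - x (i + 2)) + 8) / 96, -((1 + x i) * (3 - x (i + 2))) / 96,
    -((1 + x i) * (3 - x (i + 1))) / 96] (j - i)

theorem hexJac_mulVec_apply (x v : R3) (i : Fin 3) :
    (hexJac x *ᵥ v) i = ((3 - x (i + 1)) * (3 - x (i + 2)) + 8) / 96 * v i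
      + -((1 + x i) * (3 - x (i + 2))) / 96 * v (i + 1)
      + -((1 + x i) * (3 - x (i + 1))) / 96 * v (i + 2) := by
  simp only [Matrix.mulVec, dotProduct, sum_fin_three_cyclic _ i, hexJac, Matrix.of_apply,
    sub_self, add_sub_cancel_left, Matrix.cons_val]

theorem contDiff_hexMap {k : WithTop ℕ∞} : ContDiff ℝ k hexMap := by
  unfold hexMap
  fun_prop

theorem hasFDerivAt_hexMap (x : R3) :
    HasFDerivAt hexMap (LinearMap.toContinuousLinearMap (Matrix.toLin' (hexJac x))) x := by
  refine hasFDerivAt_pi'.2 fun i => ?_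
  have hproj (j : Fin 3) : HasFDerivAt (fun y : R3 => y j) _ x := hasFDerivAt_apply (𝕜 := ℝ) j x
  refine ((((hproj i).const_add 1).mul ((((hproj (i + 1)).const_sub 3).mul
    ((hproj (i + 2)).const_sub 3)).add_const 8)).mul_const (96 : ℝ)⁻¹).congr_fderiv ?_
  ext v
  simp only [ContinuousLinearMap.comp_apply, LinearMap.coe_toContinuousLinearMap',
    Matrix.toLin'_apply, ContinuousLinearMap.proj_apply, hexJac_mulVec_apply,
    FunLike.coe_add, FunLike.coe_smul, FunLike.coe_neg, Pi.add_apply, Pi.smul_apply, Pi.neg_apply,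
    Pi.mul_apply, smul_eq_mul]
  ring

/-- Simpson's rule is exact here: along a segment the derivative of `hexMap` is quadratic. -/
theorem hexMap_sub_hexMap (x y : R3) :
    hexMap y - hexMap x =
      ((6 : ℝ)⁻¹ • (hexJac x + (4 : ℝ) • hexJac ((2 : ℝ)⁻¹ • (x + y)) + hexJac y)) *ᵥ (y - x) := by
  ext i
  simp only [Matrix.smul_mulVec, Matrix.add_mulVec, Pi.add_apply, Pi.sub_apply, Pi.smul_apply,
    smul_eq_mul, hexJac_mulVec_apply]
  unfold hexMap
  ring

theorem mem_refCube {x : R3} : x ∈ refCube ↔ ∀ i, -1 ≤ x i ∧ x i ≤ 1 := by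
  simp only [refCube, mem_Icc, Pi.le_def, Pi.neg_apply, Pi.one_apply, forall_and]

theorem convex_refCube : Convex ℝ refCube := convex_Icc _ _

theorem measurableSet_refCube : MeasurableSet refCube := measurableSet_Icc

theorem mem_interior_refCube {x : R3} : x ∈ interior refCube ↔ ∀ i, -1 < x i ∧ x i < 1 :=
  mem_interior_Icc_pi

section Cube

variable {x : R3} (hx : x ∈ refCube)
include hx

theorem rowDominant_hexJac : RowDominant (hexJac x) := by
  rw [mem_refCube] at hx
  refine ⟨fun i j hij => ?_, fun i => ?_⟩
  · obtain ⟨k, rfl⟩ : ∃ k, j = i + k := ⟨j - i, by abel⟩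
    simp only [hexJac, Matrix.of_apply, add_sub_cancel_left]
    fin_cases k
    · simp at hij
    · have := mul_nonneg (neg_le_iff_add_nonneg'.1 (hx i).1)
        (sub_nonneg.2 ((hx (i + 2)).2.trans (by norm_num : (1 : ℝ) ≤ 3)))
      exact div_nonpos_of_nonpos_of_nonneg (neg_nonpos.2 this) (by norm_num)
    · have := mul_nonneg (neg_le_iff_add_nonneg'.1 (hx i).1)
        (sub_nonneg.2 ((hx (i + 1)).2.trans (by norm_num : (1 : ℝ) ≤ 3)))
      exact div_nonpos_of_nonpos_of_nonneg (neg_nonpos.2 this) (by norm_num)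
  · have hsum : ∑ j, hexJac x i j = (hexJac x *ᵥ 1) i := by simp [Matrix.mulVec, dotProduct]
    rw [hsum, hexJac_mulVec_apply]
    simp only [Pi.one_apply]
    nlinarith [mul_nonneg (sub_nonneg.2 (hx i).2)
        (by linarith [(hx (i + 1)).2, (hx (i + 2)).2] : 0 ≤ 6 - x (i + 1) - x (i + 2)),
      mul_nonneg (sub_nonneg.2 (hx (i + 1)).2) (sub_nonneg.2 (hx (i + 2)).2)]

theorem det_hexJac_pos : 0 < (hexJac x).det := (rowDominant_hexJac hx).det_pos

theorem hexMap_pos_iff {i : Fin 3} : 0 < hexMap x i ↔ -1 < x i := by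
  rw [mem_refCube] at hx
  have hfactor : 0 < ((3 - x (i + 1)) * (3 - x (i + 2)) + 8) / 96 := by
    nlinarith [(hx (i + 1)).2, (hx (i + 2)).2]
  rw [hexMap, mul_div_assoc, mul_pos_iff_of_pos_right hfactor, neg_lt_iff_pos_add']

theorem hexMap_lt_iff {i : Fin 3} : hexMap x i < 1 - ∑ j, hexMap x j ↔ x i < 1 := by
  rw [mem_refCube] at hx
  have hfactor : 0 < ((2 - x (i + 1)) * (2 - x (i + 2)) + 3) / 24 := by
    nlinarith [(hx (i + 1)).2, (hx (i + 2)).2]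
  have hgap : 1 - ∑ j, hexMap x j - hexMap x i
      = (1 - x i) * (((2 - x (i + 1)) * (2 - x (i + 2)) + 3) / 24) := by
    simp only [sum_fin_three_cyclic _ i, hexMap, add_assoc i, add_zero,
      show (1 + 1 : Fin 3) = 2 from rfl, show (1 + 2 : Fin 3) = 0 from rfl,
      show (2 + 1 : Fin 3) = 0 from rfl, show (2 + 2 : Fin 3) = 1 from rfl]
    ring
  rw [← sub_pos, hgap, mul_pos_iff_of_pos_right hfactor, sub_pos]

end Cube

theorem injOn_hexMap : InjOn hexMap refCube := by
  intro x hx y hy hxy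
  have hmid : (2 : ℝ)⁻¹ • (x + y) ∈ refCube := by
    rw [smul_add]
    exact convex_refCube hx hy (by norm_num) (by norm_num) (by norm_num)
  have hdom := (((rowDominant_hexJac hx).add ((rowDominant_hexJac hmid).smul zero_lt_four)).add
    (rowDominant_hexJac hy)).smul (by norm_num : (0 : ℝ) < 6⁻¹)
  have hzero := (hexMap_sub_hexMap x y).symm.trans (sub_eq_zero.2 hxy.symm)
  exact (sub_eq_zero.1 (Matrix.eq_zero_of_mulVec_eq_zero hdom.det_ne_zero hzero)).symm

/-- The image of the reference cube under `hexMap`: the points of the unit simplex at which none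
of the coordinates exceeds that of the vertex `0`. -/
def refHex : Set R3 := {z | ∀ i, 0 ≤ z i ∧ z i ≤ 1 - ∑ j, z j}

/-- The interior of `refHex`. -/
def refHexInt : Set R3 := {z | ∀ i, 0 < z i ∧ z i < 1 - ∑ j, z j}

theorem openSegment_subset_refHexInt {z w : R3} (hz : z ∈ refHex) (hw : w ∈ refHexInt) :
    openSegment ℝ z w ⊆ refHexInt := by
  rintro _ ⟨a, b, ha, hb, hab, rfl⟩ i
  obtain ⟨hz0, hz1⟩ := hz i
  obtain ⟨hw0, hw1⟩ := hw i
  simp only [Pi.add_apply, Pi.smul_apply, smul_eq_mul, Finset.sum_add_distrib, ← Finset.mul_sum]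
  constructor <;> nlinarith

theorem refHexInt_subset_refHex : refHexInt ⊆ refHex := fun _ hz i => ⟨(hz i).1.le, (hz i).2.le⟩

theorem convex_refHexInt : Convex ℝ refHexInt :=
  convex_iff_openSegment_subset.2 fun _ hz _ hw =>
    openSegment_subset_refHexInt (refHexInt_subset_refHex hz) hw

theorem hexMap_mem_refHexInt {x : R3} (hx : x ∈ refCube) :
    hexMap x ∈ refHexInt ↔ x ∈ interior refCube := by
  simp only [refHexInt, mem_ofPred_eq, hexMap_pos_iff hx, hexMap_lt_iff hx, mem_interior_refCube]

theorem zero_mem_interior_refCube : (0 : R3) ∈ interior refCube :=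
  mem_interior_refCube.2 fun i => by norm_num

theorem hexMap_zero_mem_refHexInt : hexMap 0 ∈ refHexInt :=
  (hexMap_mem_refHexInt (interior_subset zero_mem_interior_refCube)).2 zero_mem_interior_refCube

theorem closure_refHexInt : closure refHexInt = refHex := by
  refine (closure_minimal refHexInt_subset_refHex ?_).antisymm fun z hz => ?_
  · simp only [refHex, ofPred_forall, ofPred_and]
    exact isClosed_iInter fun i => (isClosed_le (by fun_prop) (by fun_prop)).inter
      (isClosed_le (by fun_prop) (by fun_prop))
  · exact closure_mono (openSegment_subset_refHexInt hz hexMap_zero_mem_refHexInt)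
      (segment_subset_closure_openSegment (left_mem_segment ℝ z _))

theorem isOpen_image_of_surjective_hasStrictFDerivAt {E F : Type*} [NormedAddCommGroup E]
    [NormedSpace ℝ E] [CompleteSpace E] [NormedAddCommGroup F] [NormedSpace ℝ F] [CompleteSpace F]
    {f : E → F} {f' : E → E →L[ℝ] F} {s : Set E} (hs : IsOpen s)
    (hf : ∀ x ∈ s, HasStrictFDerivAt f (f' x) x) (hsurj : ∀ x ∈ s, Function.Surjective (f' x)) :
    IsOpen (f '' s) := by
  refine isOpen_iff_mem_nhds.2 ?_
  rintro _ ⟨x, hx, rfl⟩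
  rw [← (hf x hx).map_nhds_eq_of_surj (LinearMap.range_eq_top.2 (hsurj x hx))]
  exact Filter.image_mem_map (hs.mem_nhds hx)

theorem isOpen_hexMap_image : IsOpen (hexMap '' interior refCube) := by
  refine isOpen_image_of_surjective_hasStrictFDerivAt isOpen_interior
    (fun x _ => contDiff_hexMap.contDiffAt.hasStrictFDerivAt' (n := 1) (hasFDerivAt_hexMap x)
      one_ne_zero) fun x hx => ?_
  exact Matrix.mulVec_surjective_iff_isUnit.2 ((Matrix.isUnit_iff_isUnit_det _).2
    (det_hexJac_pos (interior_subset hx)).ne'.isUnit)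

/-- The image of the open cube is open, and closed in `refHexInt`, which is connected. -/
theorem hexMap_image_interior_refCube : hexMap '' interior refCube = refHexInt := by
  refine Subset.antisymm (image_subset_iff.2 fun x hx =>
    (hexMap_mem_refHexInt (interior_subset hx)).2 hx) ?_
  have hclosed : IsClosed (hexMap '' refCube) :=
    (isCompact_Icc.image (contDiff_hexMap (k := 0)).continuous).isClosed
  refine convex_refHexInt.isPreconnected.subset_left_of_subset_union isOpen_hexMap_image
    hclosed.isOpen_compl (disjoint_compl_right.mono_left (image_mono interior_subset)) ?_
    ⟨_, hexMap_zero_mem_refHexInt, mem_image_of_mem _ zero_mem_interior_refCube⟩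
  intro z hz
  refine (em (z ∈ hexMap '' refCube)).imp_left ?_
  rintro ⟨x, hx, rfl⟩
  exact ⟨x, (hexMap_mem_refHexInt hx).1 hz, rfl⟩

theorem hexMap_image_refCube : hexMap '' refCube = refHex := by
  have hclosure : closure (interior refCube) = refCube := by
    rw [convex_refCube.closure_interior_eq_closure_of_nonempty_interior
      ⟨0, zero_mem_interior_refCube⟩]
    exact isClosed_Icc.closure_eq
  rw [← closure_refHexInt, ← hexMap_image_interior_refCube, ← image_closure_of_isCompact, hclosure]
  · rw [hclosure]
    exact isCompact_Icc
  · exact (contDiff_hexMap (k := 0)).continuous.continuousOn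

section Simplices

section AffineMaps

variable {E F : Type*} [AddCommGroup E] [Module ℝ E] [AddCommGroup F] [Module ℝ F]

theorem map_sum_smul_of_sum_eq_one {ι : Type*} (f : E →ᵃ[ℝ] F) (s : Finset ι) {w : ι → ℝ}
    (hw : ∑ i ∈ s, w i = 1) (p : ι → E) : f (∑ i ∈ s, w i • p i) = ∑ i ∈ s, w i • f (p i) := by
  rw [← s.affineCombination_eq_linear_combination p w hw, s.map_affineCombination p w hw,
    s.affineCombination_eq_linear_combination _ w hw]
  rfl

theorem map_add_smul_sub (f : E →ᵃ[ℝ] F) (x v w : E) (t : ℝ) :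
    f (x + t • (v - w)) = f x + t • (f v - f w) := by
  rw [add_comm x, ← vadd_eq_add, f.map_vadd, map_smul, ← vsub_eq_sub v, f.linearMap_vsub,
    vadd_eq_add, add_comm, vsub_eq_sub]

theorem eqOn_convexHull_of_eqOn {f g : E →ᵃ[ℝ] F} {s : Set E} (h : EqOn f g s) :
    EqOn f g (convexHull ℝ s) :=
  convexHull_min (t := {x | f x = g x}) h fun x hx y hy a b _ _ hab => by
    rw [mem_ofPred_eq] at hx hy ⊢
    rw [Convex.combo_affine_apply hab, Convex.combo_affine_apply hab, hx, hy]

end AffineMaps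

variable {S : Geometry.SimplicialComplex ℝ R3}

namespace Subcell

variable (K : Subcell S)

/-- The vertices of the tetrahedron of `K`, as an affine basis of `ℝ³`. -/
def vertexBasis : AffineBasis K.cell ℝ R3 where
  toFun := (↑)
  ind' := S.indep K.cell_mem
  tot' := by
    refine (S.indep K.cell_mem).affineSpan_eq_top_iff_card_eq_finrank_add_one.2 ?_
    rw [Fintype.card_coe, K.cell_card, Module.finrank_fin_fun]

open Classical in
/-- The barycentric coordinate with respect to the vertex `v` of the tetrahedron of `K`, and zero
if `v` is not a vertex of it. Thus, on the tetrahedra of the mesh, `v` fixed, these are the pieces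
of the hat function at `v`. -/
def coord (v : R3) : R3 →ᵃ[ℝ] ℝ := if h : v ∈ K.cell then K.vertexBasis.coord ⟨v, h⟩ else 0

variable {K} {v w x : R3}

theorem coord_of_mem (h : v ∈ K.cell) : K.coord v = K.vertexBasis.coord ⟨v, h⟩ := dif_pos h

theorem coord_of_notMem (h : v ∉ K.cell) : K.coord v = 0 := dif_neg h

theorem coord_apply_self (h : v ∈ K.cell) : K.coord v v = 1 := by
  rw [coord_of_mem h]
  exact K.vertexBasis.coord_apply_eq ⟨v, h⟩

theorem coord_apply_of_ne (hw : w ∈ K.cell) (h : v ≠ w) : K.coord v w = 0 := by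
  by_cases hv : v ∈ K.cell
  · rw [coord_of_mem hv]
    exact K.vertexBasis.coord_apply_ne (i := ⟨v, hv⟩) (j := ⟨w, hw⟩) (Subtype.coe_ne_coe.1 h)
  · rw [coord_of_notMem hv]
    rfl

theorem continuous_coord (v : R3) : Continuous (K.coord v) :=
  (K.coord v).continuous_of_finiteDimensional

variable (K x)

theorem sum_coord : ∑ v ∈ K.cell, K.coord v x = 1 := by
  rw [← Finset.sum_coe_sort, ← K.vertexBasis.sum_coord_apply_eq_one x]
  exact Finset.sum_congr rfl fun v _ => by rw [coord_of_mem v.2]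

theorem sum_coord_smul : ∑ v ∈ K.cell, K.coord v x • v = x := by
  rw [← Finset.sum_coe_sort]
  conv_rhs => rw [← K.vertexBasis.linear_combination_coord_eq_self x]
  exact Finset.sum_congr rfl fun v _ => by rw [coord_of_mem v.2]; rfl

theorem convexHull_cell_eq :
    convexHull ℝ (K.cell : Set R3) = {x | ∀ v, 0 ≤ K.coord v x} := by
  have hrange : (K.cell : Set R3) = range K.vertexBasis := Subtype.range_coe.symm
  rw [hrange, K.vertexBasis.convexHull_eq_nonneg_coord]
  ext x
  refine ⟨fun h v => ?_, fun h v => coord_of_mem (K := K) v.2 ▸ h v⟩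
  by_cases hv : v ∈ K.cell
  · exact coord_of_mem hv ▸ h ⟨v, hv⟩
  · rw [coord_of_notMem hv]
    exact le_rfl

theorem interior_convexHull_cell :
    interior (convexHull ℝ (K.cell : Set R3)) = {x | ∀ v ∈ K.cell, 0 < K.coord v x} := by
  have hrange : (K.cell : Set R3) = range K.vertexBasis := Subtype.range_coe.symm
  rw [hrange, K.vertexBasis.interior_convexHull]
  ext x
  exact ⟨fun h v hv => coord_of_mem hv ▸ h ⟨v, hv⟩, fun h v => coord_of_mem (K := K) v.2 ▸ h v v.2⟩

variable {K x}

theorem coord_eqOn_convexHull {K' : Subcell S} {s : Finset R3} (hs : s ⊆ K.cell)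
    (hs' : s ⊆ K'.cell) (v : R3) : EqOn (K.coord v) (K'.coord v) (convexHull ℝ (s : Set R3)) := by
  refine eqOn_convexHull_of_eqOn fun w hw => ?_
  rcases eq_or_ne v w with rfl | h
  · rw [coord_apply_self (hs hw), coord_apply_self (hs' hw)]
  · rw [coord_apply_of_ne (hs hw) h, coord_apply_of_ne (hs' hw) h]

theorem mem_of_coord_ne_zero {s : Finset R3} (hs : s ⊆ K.cell)
    (hx : x ∈ convexHull ℝ (s : Set R3)) (hv : K.coord v x ≠ 0) : v ∈ s := by
  by_contra h
  refine hv (eqOn_convexHull_of_eqOn (g := 0) (fun w hw => ?_) hx)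
  exact coord_apply_of_ne (hs hw) fun e => h (e ▸ hw)

theorem coord_bary_of_mem {s : Finset R3} (hs : s ⊆ K.cell) (hv : v ∈ s) :
    K.coord v (bary s) = (s.card : ℝ)⁻¹ := by
  have hcard : (s.card : ℝ) ≠ 0 := Nat.cast_ne_zero.2 (Finset.card_ne_zero_of_mem hv)
  rw [bary, Finset.smul_sum, map_sum_smul_of_sum_eq_one _ _ (by simp [hcard]),
    Finset.sum_eq_single_of_mem v hv fun w hw h => ?_, coord_apply_self (hs hv), smul_eq_mul,
    mul_one]
  rw [coord_apply_of_ne (hs hw) h.symm, smul_zero]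

theorem coord_bary_of_notMem {s : Finset R3} (hs : s ⊆ K.cell) (hne : s.Nonempty) (hv : v ∉ s) :
    K.coord v (bary s) = 0 := by
  have hcard : (s.card : ℝ) ≠ 0 := Nat.cast_ne_zero.2 hne.card_ne_zero
  rw [bary, Finset.smul_sum, map_sum_smul_of_sum_eq_one _ _ (by simp [hcard])]
  refine Finset.sum_eq_zero fun w hw => ?_
  rw [coord_apply_of_ne (hs hw) (ne_of_mem_of_not_mem hw hv).symm, smul_zero]

theorem eq_of_cell_of_node {K' : Subcell S} (hcell : K.cell = K'.cell) (hnode : K.node = K'.node) :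
    K = K' := by
  cases K
  cases K'
  simp_all only

end Subcell

end Simplices

section Hexahedra

variable {S : Geometry.SimplicialComplex ℝ R3} (ν : AxisLabelling S) (K : Subcell S)

theorem nonempty_axisLabelling : Nonempty (AxisLabelling S) := by
  classical
  refine ⟨fun K => ((K.cell.erase K.node).equivFinOfCardEq ?_).symm.trans
    (Equiv.subtypeEquivRight fun v => by rw [Finset.mem_erase, and_comm])⟩
  rw [Finset.card_erase_of_mem K.node_mem, K.cell_card]

theorem axis_mem (i : Fin 3) : (ν K i : R3) ∈ K.cell := (ν K i).2.1

theorem axis_ne (i : Fin 3) : (ν K i : R3) ≠ K.node := (ν K i).2.2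

theorem axis_injective : Function.Injective fun i => (ν K i : R3) :=
  Subtype.val_injective.comp (ν K).injective

theorem exists_axis_eq {v : R3} (hv : v ∈ K.cell) (hne : v ≠ K.node) :
    ∃ i, (ν K i : R3) = v :=
  ⟨(ν K).symm ⟨v, hv, hne⟩, by rw [Equiv.apply_symm_apply]⟩

theorem sum_cell_eq {M : Type*} [AddCommMonoid M] (f : R3 → M) :
    ∑ v ∈ K.cell, f v = f K.node + ∑ i, f (ν K i) := by
  classical
  let _ : Fintype {v : R3 // v ∈ K.cell ∧ v ≠ K.node} := Fintype.ofEquiv _ (ν K)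
  rw [← Finset.add_sum_erase _ _ K.node_mem, (ν K).sum_comp fun v => f v,
    Finset.sum_subtype (p := fun v => v ∈ K.cell ∧ v ≠ K.node) _
      fun v => by rw [Finset.mem_erase, and_comm]]

/-- The matrix whose columns are the edges of the tetrahedron of `K` that start at the node. -/
def edgeMatrix : Matrix (Fin 3) (Fin 3) ℝ := Matrix.of fun c i => (ν K i : R3) c - K.node c

theorem edgeMatrix_mulVec (z : R3) :
    edgeMatrix ν K *ᵥ z = ∑ i, z i • ((ν K i : R3) - K.node) := by
  ext c
  simp [edgeMatrix, Matrix.mulVec, dotProduct, mul_comm]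

theorem coord_node_eq (x : R3) : K.coord K.node x = 1 - ∑ i, K.coord (ν K i) x := by
  rw [← K.sum_coord x, sum_cell_eq ν K, add_sub_cancel_right]

theorem node_add_edgeMatrix_mulVec_coord (x : R3) :
    K.node + edgeMatrix ν K *ᵥ (fun i => K.coord (ν K i) x) = x := by
  conv_rhs => rw [← K.sum_coord_smul x, sum_cell_eq ν K, coord_node_eq ν K]
  rw [edgeMatrix_mulVec]
  simp only [smul_sub, Finset.sum_sub_distrib, sub_smul, one_smul, Finset.sum_smul]
  abel

theorem coord_node_add_edgeMatrix_mulVec (z : R3) (i : Fin 3) :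
    K.coord (ν K i) (K.node + edgeMatrix ν K *ᵥ z) = z i := by
  have hlinear (j : Fin 3) :
      (K.coord (ν K i)).linear ((ν K j : R3) - K.node) = if i = j then 1 else 0 := by
    rw [← vsub_eq_sub, AffineMap.linearMap_vsub,
      Subcell.coord_apply_of_ne K.node_mem (axis_ne ν K i), vsub_eq_sub, sub_zero]
    split_ifs with h
    · rw [h, Subcell.coord_apply_self (axis_mem ν K j)]
    · exact Subcell.coord_apply_of_ne (axis_mem ν K j) fun e => h (axis_injective ν K e)
  rw [add_comm, ← vadd_eq_add, AffineMap.map_vadd,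
    Subcell.coord_apply_of_ne K.node_mem (axis_ne ν K i), edgeMatrix_mulVec]
  simp [hlinear]

theorem det_edgeMatrix_ne_zero : (edgeMatrix ν K).det ≠ 0 := by
  refine Matrix.isUnit_iff_isUnit_det _ |>.1 (Matrix.mulVec_injective_iff_isUnit.1 ?_) |>.ne_zero
  intro z w h
  ext i
  rw [← coord_node_add_edgeMatrix_mulVec ν K z i, ← coord_node_add_edgeMatrix_mulVec ν K w i]
  exact congrArg (fun u => K.coord (ν K i) (K.node + u)) h

open Classical in
theorem coord_axis_hexVertex (σ : Finset (Fin 3)) (i : Fin 3) :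
    K.coord (ν K i) (hexVertex ν K σ) = if i ∈ σ then ((σ.card : ℝ) + 1)⁻¹ else 0 := by
  have hnode : K.node ∉ σ.image fun i => (ν K i : R3) := by simp [axis_ne]
  have hmem : (ν K i : R3) ∈ insert K.node (σ.image fun i => (ν K i : R3)) ↔ i ∈ σ := by
    rw [Finset.mem_insert, or_iff_right (axis_ne ν K i)]
    exact (axis_injective ν K).mem_finset_image
  have hsub : insert K.node (σ.image fun i => (ν K i : R3)) ⊆ K.cell :=
    Finset.insert_subset K.node_mem (Finset.image_subset_iff.2 fun j _ => axis_mem ν K j)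
  rw [hexVertex]
  split_ifs with h
  · rw [Subcell.coord_bary_of_mem hsub (hmem.2 h), Finset.card_insert_of_notMem hnode,
      Finset.card_image_of_injective _ (axis_injective ν K), Nat.cast_succ]
  · exact Subcell.coord_bary_of_notMem hsub (Finset.insert_nonempty _ _) fun h' => h (hmem.1 h')

theorem sum_trilinear_weights (x : R3) :
    ∑ σ : Finset (Fin 3), ((∏ i ∈ σ, (1 + x i) / 2) * ∏ i ∈ σᶜ, (1 - x i) / 2) = 1 := by
  rw [← Fintype.prod_add]
  exact Finset.prod_eq_one fun i _ => by ring

theorem coord_axis_trilinear (x : R3) (i : Fin 3) :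
    K.coord (ν K i) (trilinear ν K x) = hexMap x i := by
  have huniv : (Finset.univ : Finset (Finset (Fin 3))) =
      {∅, {0}, {1}, {2}, {0, 1}, {0, 2}, {1, 2}, {0, 1, 2}} := by decide
  rw [trilinear, map_sum_smul_of_sum_eq_one _ _ (sum_trilinear_weights x)]
  simp only [coord_axis_hexVertex, hexMap]
  rw [huniv]
  repeat rw [Finset.sum_insert (by decide)]
  rw [Finset.sum_singleton]
  simp only [show (∅ᶜ : Finset (Fin 3)) = {0, 1, 2} by decide,
    show ({0}ᶜ : Finset (Fin 3)) = {1, 2} by decide,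
    show ({1}ᶜ : Finset (Fin 3)) = {0, 2} by decide,
    show ({2}ᶜ : Finset (Fin 3)) = {0, 1} by decide,
    show ({0, 1}ᶜ : Finset (Fin 3)) = {2} by decide,
    show ({0, 2}ᶜ : Finset (Fin 3)) = {1} by decide,
    show ({1, 2}ᶜ : Finset (Fin 3)) = {0} by decide,
    show ({0, 1, 2}ᶜ : Finset (Fin 3)) = ∅ by decide]
  obtain rfl | rfl | rfl : i = 0 ∨ i = 1 ∨ i = 2 := by omega
  all_goals
    simp [show (1 : Fin 3) + 1 = 2 from rfl, show (1 : Fin 3) + 2 = 0 from rfl,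
      show (2 : Fin 3) + 1 = 0 from rfl, show (2 : Fin 3) + 2 = 1 from rfl]
    ring

theorem trilinear_eq (x : R3) : trilinear ν K x = K.node + edgeMatrix ν K *ᵥ hexMap x := by
  rw [← node_add_edgeMatrix_mulVec_coord ν K (trilinear ν K x)]
  simp only [coord_axis_trilinear]

theorem coord_node_trilinear (x : R3) :
    K.coord K.node (trilinear ν K x) = 1 - ∑ i, hexMap x i := by
  simp only [coord_node_eq ν K, coord_axis_trilinear]

theorem injOn_trilinear : InjOn (trilinear ν K) refCube := fun x hx y hy h =>
  injOn_hexMap hx hy (funext fun i => by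
    rw [← coord_axis_trilinear ν K, h, coord_axis_trilinear])

theorem trilinear_mem_hex {x : R3} (hx : x ∈ refCube) : trilinear ν K x ∈ K.hex := by
  classical
  rw [mem_refCube] at hx
  refine (convex_convexHull ℝ _).sum_mem (fun σ _ => ?_) (sum_trilinear_weights x)
    fun σ _ => subset_convexHull ℝ _ ⟨_, ?_, Finset.mem_insert_self _ _, rfl⟩
  · exact mul_nonneg (Finset.prod_nonneg fun i _ => by linarith [(hx i).1])
      (Finset.prod_nonneg fun i _ => by linarith [(hx i).2])
  · exact Finset.insert_subset K.node_mem (Finset.image_subset_iff.2 fun j _ => axis_mem ν K j)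

theorem coord_le_coord_node_of_mem_hex {x : R3} (hx : x ∈ K.hex) (v : R3) :
    0 ≤ K.coord v x ∧ K.coord v x ≤ K.coord K.node x := by
  refine convexHull_min (t := {x | 0 ≤ K.coord v x ∧ K.coord v x ≤ K.coord K.node x}) ?_ ?_ hx
  · rintro _ ⟨s, hs, hnode, rfl⟩
    have hcard : (0 : ℝ) ≤ (s.card : ℝ)⁻¹ := by positivity
    rw [mem_ofPred_eq, Subcell.coord_bary_of_mem hs hnode]
    by_cases hv : v ∈ s
    · rw [Subcell.coord_bary_of_mem hs hv]
      exact ⟨hcard, le_rfl⟩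
    · rw [Subcell.coord_bary_of_notMem hs ⟨_, hnode⟩ hv]
      exact ⟨le_rfl, hcard⟩
  · rintro y ⟨hy0, hy1⟩ z ⟨hz0, hz1⟩ a b ha hb hab
    simp only [mem_ofPred_eq, Convex.combo_affine_apply hab, smul_eq_mul]
    exact ⟨by positivity, by gcongr⟩

theorem mem_trilinear_image {x : R3}
    (hx : ∀ v, 0 ≤ K.coord v x ∧ K.coord v x ≤ K.coord K.node x) :
    x ∈ trilinear ν K '' refCube := by
  have hmem : (fun i => K.coord (ν K i) x) ∈ refHex := fun i => by
    rw [← coord_node_eq ν K]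
    exact hx _
  rw [← hexMap_image_refCube] at hmem
  obtain ⟨y, hy, hxy⟩ := hmem
  refine ⟨y, hy, ?_⟩
  rw [trilinear_eq, hxy, node_add_edgeMatrix_mulVec_coord]

theorem trilinear_image_refCube : trilinear ν K '' refCube = K.hex :=
  Subset.antisymm (image_subset_iff.2 fun _ hx => trilinear_mem_hex ν K hx)
    fun _ hx => mem_trilinear_image ν K (coord_le_coord_node_of_mem_hex K hx)

theorem hex_eq : K.hex = {x | ∀ v, 0 ≤ K.coord v x ∧ K.coord v x ≤ K.coord K.node x} := by
  obtain ⟨ν⟩ := nonempty_axisLabelling (S := S)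
  refine Subset.antisymm (fun x hx => coord_le_coord_node_of_mem_hex K hx) fun x hx => ?_
  rw [← trilinear_image_refCube ν K]
  exact mem_trilinear_image ν K hx

theorem hex_subset_convexHull_cell : K.hex ⊆ convexHull ℝ (K.cell : Set R3) := by
  rw [hex_eq, K.convexHull_cell_eq]
  exact fun x hx v => (hx v).1

theorem hex_subset_dualCell : K.hex ⊆ dualCell S K.node :=
  subset_biUnion_of_mem (u := fun K : Subcell S => K.hex) (x := K) rfl

end Hexahedra

section Jacobian

variable {S : Geometry.SimplicialComplex ℝ R3} (ν : AxisLabelling S) (K : Subcell S)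

theorem hasFDerivAt_trilinear (x : R3) : HasFDerivAt (trilinear ν K)
    (LinearMap.toContinuousLinearMap (Matrix.toLin' (edgeMatrix ν K * hexJac x))) x := by
  have hlinear : HasFDerivAt (fun z => edgeMatrix ν K *ᵥ z)
      (LinearMap.toContinuousLinearMap (Matrix.toLin' (edgeMatrix ν K))) (hexMap x) :=
    (LinearMap.toContinuousLinearMap (Matrix.toLin' (edgeMatrix ν K))).hasFDerivAt
  rw [show trilinear ν K = _ from funext (trilinear_eq ν K)]
  refine ((hlinear.comp x (hasFDerivAt_hexMap x)).const_add K.node).congr_fderiv ?_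
  ext v
  simp

theorem contDiff_trilinear {k : WithTop ℕ∞} : ContDiff ℝ k (trilinear ν K) := by
  rw [show trilinear ν K = _ from funext (trilinear_eq ν K)]
  exact contDiff_const.add <|
    (LinearMap.toContinuousLinearMap (Matrix.toLin' (edgeMatrix ν K))).contDiff.comp contDiff_hexMap

theorem jac_eq (x : R3) : jac ν K x = edgeMatrix ν K * hexJac x := by
  rw [jac, (hasFDerivAt_trilinear ν K x).fderiv]
  exact LinearMap.toMatrix'_toLin' _

theorem det_jac_ne_zero {x : R3} (hx : x ∈ refCube) : (jac ν K x).det ≠ 0 := by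
  rw [jac_eq, Matrix.det_mul]
  exact mul_ne_zero (det_edgeMatrix_ne_zero ν K) (det_hexJac_pos hx).ne'

/-- The sign of the Jacobian determinant of the trilinear map onto `K`. It depends on the
numbering of the axes, which is arbitrary. -/
def orientation : ℝ := SignType.sign (edgeMatrix ν K).det

theorem abs_det_jac {x : R3} (hx : x ∈ refCube) :
    |(jac ν K x).det| = orientation ν K * (jac ν K x).det := by
  rw [jac_eq, Matrix.det_mul, abs_mul, abs_of_pos (det_hexJac_pos hx), ← mul_assoc, orientation,
    sign_mul_self]

end Jacobian

section BoundaryFaces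

theorem frontier_closure_of_interior_closure_eq {X : Type*} [TopologicalSpace X] {s : Set X}
    (h : interior (closure s) = s) : frontier (closure s) = frontier s := by
  have hopen : IsOpen s := h ▸ isOpen_interior
  rw [frontier, frontier, closure_closure, h, hopen.interior_eq]

variable {S : Geometry.SimplicialComplex ℝ R3} (ν : AxisLabelling S) (K : Subcell S)

theorem card_le_four_of_mem_faces {s : Finset R3} (hs : s ∈ S.faces) : s.card ≤ 4 := by
  have hcard := (S.indep hs).card_le_finrank_succ
  have hrank := Submodule.finrank_le (vectorSpan ℝ (range ((↑) : s → R3)))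
  rw [Fintype.card_coe] at hcard
  rw [Module.finrank_fin_fun] at hrank
  exact hcard.trans (Nat.succ_le_succ hrank)

theorem eventually_mem_of_mem_convexHull_face [Finite S.faces] (x : R3) :
    ∀ᶠ y in nhds x, ∀ s ∈ S.faces,
      y ∈ convexHull ℝ (s : Set R3) → x ∈ convexHull ℝ (s : Set R3) := by
  rw [Filter.eventually_all_finite (toFinite S.faces)]
  intro s _
  by_cases h : x ∈ convexHull ℝ (s : Set R3)
  · exact .of_forall fun _ _ => h
  · have hclosed : IsClosed (convexHull ℝ (s : Set R3)) :=
      (s.finite_toSet.isCompact_convexHull ℝ).isClosed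
    exact (hclosed.isOpen_compl.eventually_mem h).mono fun y hy hy' => absurd hy' hy

variable {K}

theorem mem_convexHull_inter_of_mem {K' : Subcell S} [DecidableEq R3] {x : R3}
    (hx : x ∈ convexHull ℝ (K.cell : Set R3)) (hx' : x ∈ convexHull ℝ (K'.cell : Set R3)) :
    x ∈ convexHull ℝ ((K.cell ∩ K'.cell : Finset R3) : Set R3) := by
  rw [Finset.coe_inter]
  exact S.inter_subset_convexHull K.cell_mem K'.cell_mem ⟨hx, hx'⟩

theorem cell_eq_of_mem_interior {K' : Subcell S} {x : R3}
    (hx : x ∈ interior (convexHull ℝ (K.cell : Set R3)))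
    (hx' : x ∈ convexHull ℝ (K'.cell : Set R3)) : K.cell = K'.cell := by
  classical
  have hmem := mem_convexHull_inter_of_mem (interior_subset hx) hx'
  rw [K.interior_convexHull_cell] at hx
  refine Finset.eq_of_subset_of_card_le (fun v hv => ?_) (by rw [K.cell_card, K'.cell_card])
  exact Finset.mem_of_mem_inter_right
    (Subcell.mem_of_coord_ne_zero Finset.inter_subset_left hmem (hx v hv).ne')

theorem dualCell_inter_interior_subset_hex :
    dualCell S K.node ∩ interior (convexHull ℝ (K.cell : Set R3)) ⊆ K.hex := by
  rintro x ⟨hdual, hx⟩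
  obtain ⟨K', hnode, hx'⟩ := mem_iUnion₂.1 hdual
  have hcell := cell_eq_of_mem_interior hx (hex_subset_convexHull_cell K' hx')
  rwa [Subcell.eq_of_cell_of_node hcell (Eq.symm hnode)]

theorem coord_lt_coord_node_of_mem_interior_hex {v x : R3} (hv : v ∈ K.cell) (hne : v ≠ K.node)
    (hx : x ∈ interior K.hex) : K.coord v x < K.coord K.node x := by
  have hcont : ContinuousAt (fun t : ℝ => x + t • (v - K.node)) 0 := by fun_prop
  have hev : ∀ᶠ t in nhdsWithin (0 : ℝ) (Ioi 0), x + t • (v - K.node) ∈ K.hex :=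
    (hcont.eventually_mem (by simpa using mem_interior_iff_mem_nhds.1 hx)).filter_mono
      nhdsWithin_le_nhds
  obtain ⟨t, hmem, ht : 0 < t⟩ := (hev.and self_mem_nhdsWithin).exists
  have hle := (coord_le_coord_node_of_mem_hex K hmem v).2
  rw [map_add_smul_sub, map_add_smul_sub, Subcell.coord_apply_self hv,
    Subcell.coord_apply_self K.node_mem, Subcell.coord_apply_of_ne K.node_mem hne,
    Subcell.coord_apply_of_ne hv hne.symm, smul_eq_mul, smul_eq_mul] at hle
  linarith

theorem mem_dualBdry_space {v x : R3} (hv : v ∈ K.cell) (hne : v ≠ K.node) (hx : x ∈ K.hex)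
    (hint : x ∈ interior (convexHull ℝ (K.cell : Set R3)))
    (heq : K.coord v x = K.coord K.node x) : x ∈ dualBdry K S.space := by
  have hdual : x ∉ interior (dualCell S K.node) := fun h =>
    (coord_lt_coord_node_of_mem_interior_hex hv hne <|
      interior_maximal ((inter_subset_inter_left _ interior_subset).trans
        dualCell_inter_interior_subset_hex) (isOpen_interior.inter isOpen_interior)
        ⟨h, hint⟩).ne heq
  exact ⟨⟨⟨subset_closure hx, fun h => hdual (interior_mono (hex_subset_dualCell K) h)⟩,
    subset_closure (hex_subset_dualCell K hx), hdual⟩,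
    fun h => h.2 (interior_mono (S.convexHull_subset_space K.cell_mem) hint)⟩

theorem mem_primalBdry {v x : R3} (hv : v ∈ K.cell) (hx : x ∈ K.hex) (hzero : K.coord v x = 0) :
    x ∈ primalBdry K := by
  have hint : x ∉ interior (convexHull ℝ (K.cell : Set R3)) := fun h => by
    rw [K.interior_convexHull_cell] at h
    exact (h v hv).ne' hzero
  exact ⟨⟨subset_closure hx, fun h => hint (interior_mono (hex_subset_convexHull_cell K) h)⟩,
    subset_closure (hex_subset_convexHull_cell K hx), hint⟩

theorem mem_hex_of_coord_lt {x : R3} (hx : x ∈ convexHull ℝ (K.cell : Set R3))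
    (hlt : ∀ v ∈ K.cell, v ≠ K.node → K.coord v x < K.coord K.node x) : x ∈ K.hex := by
  rw [K.convexHull_cell_eq] at hx
  rw [hex_eq]
  refine fun v => ⟨hx v, ?_⟩
  by_cases hv : v ∈ K.cell
  · rcases eq_or_ne v K.node with rfl | hne
    · exact le_rfl
    · exact (hlt v hv hne).le
  · rw [Subcell.coord_of_notMem hv]
    exact hx K.node

theorem eventually_mem_hex {x : R3}
    (hlt : ∀ v, v ≠ K.node → K.coord v x < K.coord K.node x) :
    ∀ᶠ y in nhds x, y ∈ convexHull ℝ (K.cell : Set R3) → y ∈ K.hex := by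
  have hev : ∀ᶠ y in nhds x, ∀ v ∈ K.cell, v ≠ K.node → K.coord v y < K.coord K.node y := by
    refine (Filter.eventually_all_finset _).2 fun v _ => ?_
    rcases eq_or_ne v K.node with rfl | hne
    · exact .of_forall fun _ h => absurd rfl h
    · exact ((Subcell.continuous_coord v).continuousAt.eventually_lt
        (Subcell.continuous_coord K.node).continuousAt (hlt v hne)).mono fun _ h _ => h
  exact hev.mono fun y hy hmem => mem_hex_of_coord_lt hmem hy

/-- The barycentric coordinates of `x` agree in all the tetrahedra that contain `x`, so the
hypothesis on `x` in one of them holds in all of them. -/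
theorem eventually_mem_hex_of_node_eq [Finite S.faces] {x : R3}
    (hx : x ∈ convexHull ℝ (K.cell : Set R3))
    (hlt : ∀ v, v ≠ K.node → K.coord v x < K.coord K.node x) :
    ∀ᶠ y in nhds x, ∀ K' : Subcell S, K'.node = K.node →
      x ∈ convexHull ℝ (K'.cell : Set R3) → y ∈ convexHull ℝ (K'.cell : Set R3) → y ∈ K'.hex := by
  classical
  refine Filter.eventually_all.2 fun K' => ?_
  by_cases hK' : K'.node = K.node ∧ x ∈ convexHull ℝ (K'.cell : Set R3)
  · have hcoord (v : R3) : K'.coord v x = K.coord v x :=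
      (Subcell.coord_eqOn_convexHull Finset.inter_subset_left Finset.inter_subset_right v
        (mem_convexHull_inter_of_mem hx hK'.2)).symm
    refine (eventually_mem_hex (K := K') (x := x) fun v hv => ?_).mono fun y hy _ _ => hy
    rw [hcoord, hcoord, hK'.1]
    exact hlt v (hK'.1 ▸ hv)
  · exact .of_forall fun y hnode hmem => absurd ⟨hnode, hmem⟩ hK'

theorem exists_node_eq_and_subset_cell [DecidableEq R3] {s : Finset R3} (hs : s ∈ S.faces) {v : R3}
    (hv : v ≠ K.node) (hsub : K.cell.erase v ⊆ s) :
    ∃ K' : Subcell S, K'.node = K.node ∧ s ⊆ K'.cell := by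
  rcases (card_le_four_of_mem_faces hs).eq_or_lt with hcard | hcard
  · exact ⟨⟨s, hs, hcard, K.node, hsub (Finset.mem_erase.2 ⟨hv.symm, K.node_mem⟩)⟩, rfl, subset_rfl⟩
  · have hle : s.card ≤ (K.cell.erase v).card :=
      Nat.le_trans (by rw [K.cell_card]; lia) Finset.pred_card_le_card_erase
    exact ⟨K, rfl, Finset.eq_of_subset_of_card_le hsub hle ▸ Finset.erase_subset _ _⟩

/-- Near such a point `x` of the face opposite to `v`, every simplex of the mesh contains the
whole face, and each of its tetrahedra agrees with its hexahedron at the node. -/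
theorem mem_interior_dualCell [Finite S.faces] {v x : R3} (hv : v ≠ K.node)
    (hx : x ∈ convexHull ℝ (K.cell : Set R3)) (hpos : ∀ w ∈ K.cell, w ≠ v → 0 < K.coord w x)
    (hlt : ∀ w, w ≠ K.node → K.coord w x < K.coord K.node x) (hint : x ∈ interior S.space) :
    x ∈ interior (dualCell S K.node) := by
  classical
  rw [mem_interior_iff_mem_nhds] at hint ⊢
  filter_upwards [eventually_mem_hex_of_node_eq hx hlt,
    eventually_mem_of_mem_convexHull_face (S := S) x, hint] with y hhex hnear hy
  obtain ⟨s, hs, hys⟩ := S.mem_space_iff.1 hy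
  have hxs := hnear s hs hys
  have hsub : K.cell.erase v ⊆ s := fun w hw => by
    obtain ⟨hwv, hw⟩ := Finset.mem_erase.1 hw
    have hmem := S.inter_subset_convexHull K.cell_mem hs ⟨hx, hxs⟩
    rw [← Finset.coe_inter] at hmem
    exact Finset.mem_of_mem_inter_right
      (Subcell.mem_of_coord_ne_zero Finset.inter_subset_left hmem (hpos w hw hwv).ne')
  obtain ⟨K', hnode, hs'⟩ := exists_node_eq_and_subset_cell hs hv hsub
  have hmono := convexHull_mono (𝕜 := ℝ) (Finset.coe_subset.2 hs')
  rw [← hnode]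
  exact hex_subset_dualCell K' (hhex K' hnode (hmono hxs) (hmono hys))

variable (K)

theorem trilinear_mem_interior_convexHull_cell {x : R3} (hx : x ∈ refCube) (hlt : ∀ j, -1 < x j) :
    trilinear ν K x ∈ interior (convexHull ℝ (K.cell : Set R3)) := by
  have hpos (i : Fin 3) : 0 < K.coord (ν K i) (trilinear ν K x) := by
    rw [coord_axis_trilinear]
    exact (hexMap_pos_iff hx).2 (hlt i)
  rw [K.interior_convexHull_cell]
  intro v hv
  rcases eq_or_ne v K.node with rfl | hne
  · exact (hpos 0).trans_le (coord_le_coord_node_of_mem_hex K (trilinear_mem_hex ν K hx) _).2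
  · obtain ⟨i, rfl⟩ := exists_axis_eq ν K hv hne
    exact hpos i

theorem trilinear_notMem_primalBdry {x : R3} (hx : x ∈ refCube) (hlt : ∀ j, -1 < x j) :
    trilinear ν K x ∉ primalBdry K := fun h =>
  h.2.2 (trilinear_mem_interior_convexHull_cell ν K hx hlt)

theorem coord_axis_lt_coord_node_trilinear_iff {x : R3} (hx : x ∈ refCube) {i : Fin 3} :
    K.coord (ν K i) (trilinear ν K x) < K.coord K.node (trilinear ν K x) ↔ x i < 1 := by
  rw [coord_axis_trilinear, coord_node_trilinear, hexMap_lt_iff hx]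

theorem trilinear_mem_dualBdry_space {x : R3} (hx : x ∈ refCube) (hlt : ∀ j, -1 < x j) {i : Fin 3}
    (hi : x i = 1) : trilinear ν K x ∈ dualBdry K S.space := by
  have hmem := trilinear_mem_hex ν K hx
  refine mem_dualBdry_space (axis_mem ν K i) (axis_ne ν K i) hmem
    (trilinear_mem_interior_convexHull_cell ν K hx hlt)
    ((coord_le_coord_node_of_mem_hex K hmem _).2.antisymm (not_lt.1 ?_))
  rw [coord_axis_lt_coord_node_trilinear_iff ν K hx]
  exact hi.not_lt

theorem trilinear_mem_primalBdry {x : R3} (hx : x ∈ refCube) {i : Fin 3} (hi : x i = -1) :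
    trilinear ν K x ∈ primalBdry K := by
  refine mem_primalBdry (axis_mem ν K i) (trilinear_mem_hex ν K hx) ?_
  rw [coord_axis_trilinear, hexMap, hi]
  ring

theorem trilinear_notMem_dualBdry_space [Finite S.faces] {x : R3} (hx : x ∈ refCube)
    (hlt : ∀ j, x j < 1) {i : Fin 3} (hpos : ∀ j, j ≠ i → -1 < x j) :
    trilinear ν K x ∉ dualBdry K S.space := by
  have hmem := trilinear_mem_hex ν K hx
  have haxis (j : Fin 3) := (coord_axis_lt_coord_node_trilinear_iff ν K hx).2 (hlt j)
  have hnode : 0 < K.coord K.node (trilinear ν K x) :=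
    (coord_le_coord_node_of_mem_hex K hmem _).1.trans_lt (haxis i)
  refine fun h => h.1.2.2 (mem_interior_dualCell (axis_ne ν K i)
    (hex_subset_convexHull_cell K hmem) (fun v hv hne => ?_) (fun v hv => ?_) ?_)
  · rcases eq_or_ne v K.node with rfl | hv'
    · exact hnode
    · obtain ⟨j, rfl⟩ := exists_axis_eq ν K hv hv'
      rw [coord_axis_trilinear, hexMap_pos_iff hx]
      exact hpos j fun h => hne (h ▸ rfl)
  · by_cases hv' : v ∈ K.cell
    · obtain ⟨j, rfl⟩ := exists_axis_eq ν K hv' hv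
      exact haxis j
    · rwa [Subcell.coord_of_notMem hv']
  · by_contra hint
    exact h.2 ⟨subset_closure (S.convexHull_subset_space K.cell_mem
      (hex_subset_convexHull_cell K hmem)), hint⟩

theorem facePoint_self (i : Fin 3) (s : ℝ) (y : Fin 2 → ℝ) : facePoint i s y i = s := by
  rw [facePoint, Fin.insertNth_apply_same]

theorem facePoint_succAbove (i : Fin 3) (s : ℝ) (y : Fin 2 → ℝ) (k : Fin 2) :
    facePoint i s y (i.succAbove k) = y k := by
  rw [facePoint, Fin.insertNth_apply_succAbove]

theorem facePoint_mem_refCube {i : Fin 3} {s : ℝ} (hs : s ∈ Icc (-1 : ℝ) 1) {y : Fin 2 → ℝ}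
    (hy : y ∈ Icc (-1) 1) : facePoint i s y ∈ refCube := by
  refine mem_refCube.2 (i.forall_iff_succAbove.2 ⟨?_, fun k => ?_⟩)
  · rwa [facePoint_self]
  · rw [facePoint_succAbove]
    exact ⟨hy.1 k, hy.2 k⟩

theorem setIntegral_face_eq_of_mem {A : Set R3} {i : Fin 3} {s : ℝ} (f : (Fin 2 → ℝ) → ℝ)
    (h : ∀ y ∈ interior (Icc (-1) 1 : Set (Fin 2 → ℝ)), trilinear ν K (facePoint i s y) ∈ A) :
    ∫ y in {y : Fin 2 → ℝ | y ∈ Icc (-1) 1 ∧ trilinear ν K (facePoint i s y) ∈ A}, f y =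
      ∫ y in Icc (-1) 1, f y := by
  refine setIntegral_congr_set ?_
  filter_upwards [(interior_ae_eq_of_convex volume (convex_Icc _ _)).mem_iff] with y hy
  exact propext ⟨fun hy' => hy'.1, fun hy' => ⟨hy', h y (hy.2 hy')⟩⟩

theorem setIntegral_face_eq_zero_of_notMem {A : Set R3} {i : Fin 3} {s : ℝ} (f : (Fin 2 → ℝ) → ℝ)
    (h : ∀ y ∈ interior (Icc (-1) 1 : Set (Fin 2 → ℝ)), trilinear ν K (facePoint i s y) ∉ A) :
    ∫ y in {y : Fin 2 → ℝ | y ∈ Icc (-1) 1 ∧ trilinear ν K (facePoint i s y) ∈ A}, f y = 0 := by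
  refine setIntegral_measure_zero _ (measure_mono_null (fun y hy => ?_)
    (ae_le_set.1 (interior_ae_eq_of_convex volume (convex_Icc (-1) 1)).symm.le))
  exact ⟨hy.1, fun hy' => h y hy' hy.2⟩

theorem lt_facePoint {i : Fin 3} {s : ℝ} (hs : -1 < s) {y : Fin 2 → ℝ}
    (hy : y ∈ interior (Icc (-1) 1)) (j : Fin 3) : -1 < facePoint i s y j := by
  revert j
  refine i.forall_iff_succAbove.2 ⟨?_, fun k => ?_⟩
  · rwa [facePoint_self]
  · rw [facePoint_succAbove]
    exact (mem_interior_Icc_pi.1 hy k).1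

theorem facePoint_lt {i : Fin 3} {s : ℝ} (hs : s < 1) {y : Fin 2 → ℝ}
    (hy : y ∈ interior (Icc (-1) 1)) (j : Fin 3) : facePoint i s y j < 1 := by
  revert j
  refine i.forall_iff_succAbove.2 ⟨?_, fun k => ?_⟩
  · rwa [facePoint_self]
  · rw [facePoint_succAbove]
    exact (mem_interior_Icc_pi.1 hy k).2

theorem flux_dualBdry_space [Finite S.faces] (v : R3 → R3) :
    flux ν K (dualBdry K S.space) v = ∑ i, ∫ y in Icc (-1) 1, fluxDensity ν K v i 1 y := by
  refine Finset.sum_congr rfl fun i _ => ?_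
  rw [Finset.sum_pair (by norm_num), setIntegral_face_eq_zero_of_notMem ν K _ fun y hy => ?_,
    setIntegral_face_eq_of_mem ν K _ fun y hy => ?_, zero_add]
  · exact trilinear_mem_dualBdry_space ν K
      (facePoint_mem_refCube (by norm_num) (interior_subset hy)) (lt_facePoint (by norm_num) hy)
      (facePoint_self i 1 y)
  · refine trilinear_notMem_dualBdry_space ν K
      (facePoint_mem_refCube (by norm_num) (interior_subset hy)) (facePoint_lt (by norm_num) hy)
      (i := i) fun j hj => ?_
    obtain ⟨k, rfl⟩ := Fin.exists_succAbove_eq hj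
    rw [facePoint_succAbove]
    exact (mem_interior_Icc_pi.1 hy k).1

theorem flux_primalBdry (v : R3 → R3) :
    flux ν K (primalBdry K) v = ∑ i, ∫ y in Icc (-1) 1, fluxDensity ν K v i (-1) y := by
  refine Finset.sum_congr rfl fun i _ => ?_
  rw [Finset.sum_pair (by norm_num), setIntegral_face_eq_of_mem ν K _ fun y hy => ?_,
    setIntegral_face_eq_zero_of_notMem ν K _ fun y hy => ?_, add_zero]
  · exact trilinear_notMem_primalBdry ν K
      (facePoint_mem_refCube (by norm_num) (interior_subset hy)) (lt_facePoint (by norm_num) hy)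
  · exact trilinear_mem_primalBdry ν K
      (facePoint_mem_refCube (by norm_num) (interior_subset hy)) (facePoint_self i (-1) y)

end BoundaryFaces

section VectorCalculus

theorem mulVec_cross_mulVec {R : Type*} [CommRing R] (M : Matrix (Fin 3) (Fin 3) R)
    (p q : Fin 3 → R) : (M *ᵥ p) ⨯₃ (M *ᵥ q) = M.adjugateᵀ *ᵥ (p ⨯₃ q) := by
  rw [Matrix.adjugate_fin_three]
  ext i
  fin_cases i <;>
    simp [cross_apply, Matrix.mulVec, dotProduct, Fin.sum_univ_three] <;> ring

theorem mulVec_cross_mulVec_dotProduct_mulVec {R : Type*} [CommRing R]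
    (M : Matrix (Fin 3) (Fin 3) R) (p q r : Fin 3 → R) :
    (M *ᵥ p) ⨯₃ (M *ᵥ q) ⬝ᵥ (M *ᵥ r) = M.det * (p ⨯₃ q ⬝ᵥ r) := by
  rw [mulVec_cross_mulVec, Matrix.mulVec_transpose, ← Matrix.dotProduct_mulVec,
    Matrix.mulVec_mulVec, Matrix.adjugate_mul, Matrix.smul_mulVec, Matrix.one_mulVec,
    dotProduct_smul, smul_eq_mul]

theorem eq_of_dotProduct_cross {R : Type*} [CommRing R] {u w : Fin 3 → R}
    (h : ∀ p q : Fin 3 → R, u ⬝ᵥ (p ⨯₃ q) = w ⬝ᵥ (p ⨯₃ q)) : u = w := by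
  have h0 : u 0 = w 0 := by
    simpa [cross_apply, dotProduct, Fin.sum_univ_three] using h ![0, 1, 0] ![0, 0, 1]
  have h1 : u 1 = w 1 := by
    simpa [cross_apply, dotProduct, Fin.sum_univ_three] using h ![0, 0, 1] ![1, 0, 0]
  have h2 : u 2 = w 2 := by
    simpa [cross_apply, dotProduct, Fin.sum_univ_three] using h ![1, 0, 0] ![0, 1, 0]
  ext i
  fin_cases i
  exacts [h0, h1, h2]

variable {u w : R3 → R3} {x : R3}

theorem curl_dotProduct_cross (u : R3 → R3) (x p q : R3) :
    curl u x ⬝ᵥ (p ⨯₃ q) = fderiv ℝ u x p ⬝ᵥ q - fderiv ℝ u x q ⬝ᵥ p := by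
  have hsum (a : R3) : fderiv ℝ u x a = ∑ j, a j • fderiv ℝ u x (Pi.single j 1) := by
    conv_lhs => rw [pi_eq_sum_univ' a]
    simp only [map_sum, map_smul]
  rw [hsum p, hsum q]
  simp [curl, cross_apply, dotProduct, Fin.sum_univ_three]
  ring

/-- The second derivatives of `F` cancel by symmetry. -/
theorem curl_pullback {F v : R3 → R3} (hF : ContDiffAt ℝ 2 F x)
    (hv : DifferentiableAt ℝ v (F x))
    (h : ∀ᶠ y in nhds x, ∀ a, u y ⬝ᵥ a = v (F y) ⬝ᵥ fderiv ℝ F y a) :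
    curl u x =
      (LinearMap.toMatrix' (fderiv ℝ F x : R3 →ₗ[ℝ] R3)).adjugate *ᵥ curl v (F x) := by
  let dot : R3 →L[ℝ] R3 →L[ℝ] ℝ := LinearMap.toContinuousBilinearMap (dotProductBilin ℝ ℝ)
  have hF1 := (hF.differentiableAt (by norm_num)).hasFDerivAt
  have hF2 := ((hF.fderiv_right (m := 1) (by norm_num)).differentiableAt (by norm_num)).hasFDerivAt
  have hpullback (a : R3) := (dot.hasFDerivAt_of_bilinear (hv.hasFDerivAt.comp x hF1)
    (hF2.clm_apply (hasFDerivAt_const a x))).congr_of_eventuallyEq (h.mono fun y hy => hy a)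
  have hu : DifferentiableAt ℝ u x := differentiableAt_pi.2 fun i => by
    simpa using (hpullback (Pi.single i 1)).differentiableAt
  have hderiv (a b : R3) : fderiv ℝ u x b ⬝ᵥ a =
      fderiv ℝ v (F x) (fderiv ℝ F x b) ⬝ᵥ fderiv ℝ F x a
        + v (F x) ⬝ᵥ fderiv ℝ (fderiv ℝ F) x b a := by
    have hdot := (dot.hasFDerivAt_of_bilinear hu.hasFDerivAt (hasFDerivAt_const a x)).unique
      (hpullback a)
    rw [add_comm]
    simpa [dot] using DFunLike.congr_fun hdot b
  have hsymm : IsSymmSndFDerivAt ℝ F x := hF.isSymmSndFDerivAt (by simp)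
  refine eq_of_dotProduct_cross fun p q => ?_
  have hcross := mulVec_cross_mulVec (LinearMap.toMatrix' (fderiv ℝ F x : R3 →ₗ[ℝ] R3)) p q
  simp only [LinearMap.toMatrix'_mulVec, ContinuousLinearMap.coe_coe] at hcross
  rw [← Matrix.vecMul_transpose, ← Matrix.dotProduct_mulVec, ← hcross, curl_dotProduct_cross,
    curl_dotProduct_cross, hderiv, hderiv, hsymm.eq p q]
  ring

theorem div_cross (hu : DifferentiableAt ℝ u x) (hw : DifferentiableAt ℝ w x) :
    ∑ i, fderiv ℝ (fun x => u x ⨯₃ w x) x (Pi.single i 1) i =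
      curl u x ⬝ᵥ w x - curl w x ⬝ᵥ u x := by
  let cross : R3 →L[ℝ] R3 →L[ℝ] R3 := LinearMap.toContinuousBilinearMap crossProduct
  have hcross : fderiv ℝ (fun x => u x ⨯₃ w x) x = _ :=
    (cross.hasFDerivAt_of_bilinear hu.hasFDerivAt hw.hasFDerivAt).fderiv
  rw [hcross]
  simp [cross, curl, cross_apply, dotProduct, Fin.sum_univ_three]
  ring

theorem contDiff_cross {k : WithTop ℕ∞} (hu : ContDiff ℝ k u) (hw : ContDiff ℝ k w) :
    ContDiff ℝ k fun x => u x ⨯₃ w x :=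
  ((LinearMap.toContinuousBilinearMap (crossProduct (R := ℝ))).contDiff.comp hu).clm_apply hw

theorem continuous_curl (hu : ContDiff ℝ 1 u) : Continuous (curl u) := by
  have hderiv (i j : Fin 3) : Continuous fun x => fderiv ℝ u x (Pi.single j 1) i :=
    (continuous_apply i).comp ((hu.continuous_fderiv one_ne_zero).clm_apply continuous_const)
  refine continuous_pi fun i => ?_
  fin_cases i
  exacts [(hderiv 2 1).sub (hderiv 1 2), (hderiv 0 2).sub (hderiv 2 0),
    (hderiv 1 0).sub (hderiv 0 1)]

theorem integrableOn_refCube_curl_dotProduct (hu : ContDiff ℝ 1 u) (hw : ContDiff ℝ 1 w) :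
    IntegrableOn (fun x => curl u x ⬝ᵥ w x) refCube :=
  ((continuous_curl hu).dotProduct hw.continuous).continuousOn.integrableOn_compact isCompact_Icc

theorem integral_refCube_curl_dotProduct_sub (hu : ContDiff ℝ 1 u) (hw : ContDiff ℝ 1 w) :
    (∫ x in refCube, curl u x ⬝ᵥ w x) - ∫ x in refCube, curl w x ⬝ᵥ u x =
      ∑ i, ((∫ y in Icc (-1) 1, (u (facePoint i 1 y) ⨯₃ w (facePoint i 1 y)) i) -
        ∫ y in Icc (-1) 1, (u (facePoint i (-1) y) ⨯₃ w (facePoint i (-1) y)) i) := by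
  have hu' := hu.differentiable one_ne_zero
  have hw' := hw.differentiable one_ne_zero
  have hcross := contDiff_cross hu hw
  have hu_int := integrableOn_refCube_curl_dotProduct hu hw
  have hw_int := integrableOn_refCube_curl_dotProduct hw hu
  rw [← integral_sub hu_int hw_int]
  simp only [← div_cross (hu' _) (hw' _)]
  refine integral_divergence_of_hasFDerivAt_off_countable (-1 : R3) 1
    (fun i => by norm_num [Pi.le_def]) (fun x => u x ⨯₃ w x) _ ∅ countable_empty
    hcross.continuous.continuousOn
    (fun x _ => (hcross.differentiable one_ne_zero x).hasFDerivAt) ?_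
  simp only [div_cross (hu' _) (hw' _)]
  exact hu_int.sub hw_int

end VectorCalculus

section PiolaTransform

theorem hasStrictFDerivAt_invFunOn {𝕜 E F : Type*} [RCLike 𝕜] [NormedAddCommGroup E]
    [NormedSpace 𝕜 E] [CompleteSpace E] [NormedAddCommGroup F] [NormedSpace 𝕜 F] {f : E → F}
    {f' : E ≃L[𝕜] F} {s : Set E} {a : E} (hf : HasStrictFDerivAt f (f' : E →L[𝕜] F) a)
    (hinj : InjOn f s) (hs : s ∈ nhds a) :
    HasStrictFDerivAt (Function.invFunOn f s) (f'.symm : F →L[𝕜] E) (f a) :=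
  hf.to_local_left_inverse (Filter.eventually_of_mem hs fun _ hx => hinj.leftInvOn_invFunOn hx)

variable {S : Geometry.SimplicialComplex ℝ R3} (ν : AxisLabelling S) (K : Subcell S)

section Piola

theorem jac_mulVec (x a : R3) : jac ν K x *ᵥ a = fderiv ℝ (trilinear ν K) x a :=
  LinearMap.toMatrix'_mulVec _ _

theorem det_fderiv_trilinear (x : R3) : (fderiv ℝ (trilinear ν K) x).det = (jac ν K x).det :=
  (LinearMap.det_toMatrix' _).symm

theorem invFunOn_trilinear {x : R3} (hx : x ∈ refCube) :
    Function.invFunOn (trilinear ν K) refCube (trilinear ν K x) = x :=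
  (injOn_trilinear ν K).leftInvOn_invFunOn hx

theorem piola_trilinear (v : R3 → R3) {x : R3} (hx : x ∈ refCube) :
    piola ν K v (trilinear ν K x) = ((jac ν K x)⁻¹)ᵀ *ᵥ v x := by
  rw [piola, invFunOn_trilinear ν K hx]

theorem piola_trilinear_dotProduct_fderiv (v : R3 → R3) {x : R3} (hx : x ∈ refCube) (a : R3) :
    piola ν K v (trilinear ν K x) ⬝ᵥ fderiv ℝ (trilinear ν K) x a = v x ⬝ᵥ a := by
  rw [piola_trilinear ν K v hx, ← jac_mulVec, dotProduct_comm,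
    mulVec_dotProduct_transpose_inv_mulVec (det_jac_ne_zero ν K hx).isUnit, dotProduct_comm]

theorem differentiable_jac_apply (i j : Fin 3) : Differentiable ℝ fun x => jac ν K x i j := by
  have hderiv : ContDiff ℝ 1 fun x => fderiv ℝ (trilinear ν K) x (Pi.single j 1) :=
    ((contDiff_trilinear ν K (k := 2)).fderiv_right (by norm_num)).clm_apply contDiff_const
  simp only [← jac_mulVec, Matrix.mulVec_single_one] at hderiv
  exact differentiable_pi.1 (hderiv.differentiable one_ne_zero) i

variable {u w : R3 → R3} {x : R3}

theorem differentiableAt_piola (hx : x ∈ interior refCube) (hu : DifferentiableAt ℝ u x) :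
    DifferentiableAt ℝ (piola ν K u) (trilinear ν K x) := by
  have hdet := det_jac_ne_zero ν K (interior_subset hx)
  have hstrict : HasStrictFDerivAt (trilinear ν K)
      (((fderiv ℝ (trilinear ν K) x).toContinuousLinearEquivOfDetNeZero
        (det_fderiv_trilinear ν K x ▸ hdet) : R3 ≃L[ℝ] R3) : R3 →L[ℝ] R3) x :=
    (contDiff_trilinear ν K (k := 1)).contDiffAt.hasStrictFDerivAt one_ne_zero
  have hinv := (hasStrictFDerivAt_invFunOn hstrict (injOn_trilinear ν K)
    (mem_interior_iff_mem_nhds.1 hx)).hasFDerivAt.differentiableAt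
  refine DifferentiableAt.comp (g := fun z => ((jac ν K z)⁻¹)ᵀ *ᵥ u z) _ ?_ hinv
  rw [invFunOn_trilinear ν K (interior_subset hx)]
  exact differentiableAt_transpose_inv_mulVec (fun i j => differentiable_jac_apply ν K i j x)
    hdet hu

theorem curl_piola_dotProduct_piola (w : R3 → R3) (hx : x ∈ interior refCube)
    (hu : DifferentiableAt ℝ u x) :
    curl (piola ν K u) (trilinear ν K x) ⬝ᵥ piola ν K w (trilinear ν K x) =
      (jac ν K x).det⁻¹ * (curl u x ⬝ᵥ w x) := by
  have hcurl : curl u x = (jac ν K x).adjugate *ᵥ curl (piola ν K u) (trilinear ν K x) := by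
    refine curl_pullback (contDiff_trilinear ν K).contDiffAt (differentiableAt_piola ν K hx hu) ?_
    filter_upwards [isOpen_interior.mem_nhds hx] with y hy a
    exact (piola_trilinear_dotProduct_fderiv ν K u (interior_subset hy) a).symm
  rw [piola_trilinear ν K w (interior_subset hx), hcurl, Matrix.inv_def, Ring.inverse_eq_inv',
    Matrix.dotProduct_mulVec, Matrix.vecMul_transpose, Matrix.smul_mulVec, smul_dotProduct,
    smul_eq_mul]

theorem fluxDensity_piola_cross_piola (u w : R3 → R3) (i : Fin 3) {s : ℝ} {y : Fin 2 → ℝ}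
    (hs : s ∈ Icc (-1 : ℝ) 1) (hy : y ∈ Icc (-1) 1) :
    fluxDensity ν K (fun x => piola ν K u x ⨯₃ piola ν K w x) i s y =
      orientation ν K * s * (u (facePoint i s y) ⨯₃ w (facePoint i s y)) i := by
  have hx := facePoint_mem_refCube (i := i) hs hy
  have hdet := det_jac_ne_zero ν K hx
  simp only [fluxDensity, piola_trilinear ν K _ hx]
  rw [dotProduct_smul, mulVec_cross_mulVec_dotProduct_mulVec, abs_det_jac ν K hx,
    Matrix.det_transpose, Matrix.det_nonsing_inv, Ring.inverse_eq_inv', dotProduct_single,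
    smul_eq_mul]
  field_simp

end Piola

section Integrals

variable {u w : R3 → R3}

theorem hasFDerivWithinAt_trilinear (x : R3) :
    HasFDerivWithinAt (trilinear ν K) (fderiv ℝ (trilinear ν K) x) refCube x :=
  (hasFDerivAt_trilinear ν K x).differentiableAt.hasFDerivAt.hasFDerivWithinAt

/-- The field `piola ν K u` need not be differentiable at boundary points of `K`, whence only an
almost everywhere equality. -/
theorem abs_det_smul_curl_piola_ae_eq (w : R3 → R3) (hu : ContDiff ℝ 1 u) :
    (fun x => |(fderiv ℝ (trilinear ν K) x).det| •
        (curl (piola ν K u) (trilinear ν K x) ⬝ᵥ piola ν K w (trilinear ν K x)))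
      =ᵐ[volume.restrict refCube] fun x => orientation ν K * (curl u x ⬝ᵥ w x) := by
  rw [← Measure.restrict_congr_set (interior_ae_eq_of_convex volume convex_refCube)]
  refine ae_restrict_of_forall_mem measurableSet_interior fun x hx => ?_
  have hdet := det_jac_ne_zero ν K (interior_subset hx)
  dsimp only
  rw [det_fderiv_trilinear, abs_det_jac ν K (interior_subset hx),
    curl_piola_dotProduct_piola ν K w hx (hu.differentiable one_ne_zero x), smul_eq_mul]
  field_simp

theorem integrableOn_hex_curl_piola (hu : ContDiff ℝ 1 u) (hw : ContDiff ℝ 1 w) :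
    IntegrableOn (fun x => curl (piola ν K u) x ⬝ᵥ piola ν K w x) K.hex := by
  rw [← trilinear_image_refCube ν K, integrableOn_image_iff_integrableOn_abs_det_fderiv_smul volume
    measurableSet_refCube (fun x _ => hasFDerivWithinAt_trilinear ν K x) (injOn_trilinear ν K)]
  exact Integrable.congr ((integrableOn_refCube_curl_dotProduct hu hw).const_mul _)
    (abs_det_smul_curl_piola_ae_eq ν K w hu).symm

theorem integral_hex_curl_piola (w : R3 → R3) (hu : ContDiff ℝ 1 u) :
    ∫ x in K.hex, curl (piola ν K u) x ⬝ᵥ piola ν K w x =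
      orientation ν K * ∫ x in refCube, curl u x ⬝ᵥ w x := by
  rw [← trilinear_image_refCube ν K, integral_image_eq_integral_abs_det_fderiv_smul volume
    measurableSet_refCube (fun x _ => hasFDerivWithinAt_trilinear ν K x) (injOn_trilinear ν K),
    integral_congr_ae (abs_det_smul_curl_piola_ae_eq ν K w hu), integral_const_mul]

theorem integrableOn_fluxDensity_piola (hu : Continuous u) (hw : Continuous w) (i : Fin 3)
    {s : ℝ} (hs : s ∈ Icc (-1 : ℝ) 1) :
    IntegrableOn (fluxDensity ν K (fun x => piola ν K u x ⨯₃ piola ν K w x) i s)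
      (Icc (-1) 1) := by
  have hface : Continuous (facePoint i s) := continuous_const.finInsertNth i continuous_id
  have hcross : Continuous fun y => (u (facePoint i s y) ⨯₃ w (facePoint i s y)) i :=
    (continuous_apply i).comp
      ((contDiff_cross (contDiff_zero.2 hu) (contDiff_zero.2 hw)).continuous.comp hface)
  exact ((hcross.const_mul _).continuousOn.integrableOn_compact isCompact_Icc).congr_fun
    (fun y hy => (fluxDensity_piola_cross_piola ν K u w i hs hy).symm) measurableSet_Icc

theorem integral_fluxDensity_piola (u w : R3 → R3) (i : Fin 3) {s : ℝ}
    (hs : s ∈ Icc (-1 : ℝ) 1) :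
    ∫ y in Icc (-1) 1, fluxDensity ν K (fun x => piola ν K u x ⨯₃ piola ν K w x) i s y =
      orientation ν K * s * ∫ y in Icc (-1) 1, (u (facePoint i s y) ⨯₃ w (facePoint i s y)) i := by
  rw [setIntegral_congr_fun measurableSet_Icc fun y hy =>
    fluxDensity_piola_cross_piola ν K u w i hs hy, integral_const_mul]

theorem flux_dualBdry_space_piola [Finite S.faces] (u w : R3 → R3) :
    flux ν K (dualBdry K S.space) (fun x => piola ν K u x ⨯₃ piola ν K w x) =
      orientation ν K *
        ∑ i, ∫ y in Icc (-1) 1, (u (facePoint i 1 y) ⨯₃ w (facePoint i 1 y)) i := by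
  simp only [flux_dualBdry_space, integral_fluxDensity_piola ν K u w _ (s := 1) (by norm_num),
    mul_one, Finset.mul_sum]

theorem flux_primalBdry_piola (u w : R3 → R3) :
    flux ν K (primalBdry K) (fun x => piola ν K u x ⨯₃ piola ν K w x) =
      -(orientation ν K *
        ∑ i, ∫ y in Icc (-1) 1, (u (facePoint i (-1) y) ⨯₃ w (facePoint i (-1) y)) i) := by
  simp only [flux_primalBdry, integral_fluxDensity_piola ν K u w _ (s := -1) (by norm_num),
    mul_neg_one, neg_mul, Finset.sum_neg_distrib, Finset.mul_sum]

theorem neg_flux_add_integral_curl_piola_comm [Finite S.faces] (hu : ContDiff ℝ 1 u)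
    (hw : ContDiff ℝ 1 w) :
    -flux ν K (dualBdry K S.space) (fun x => piola ν K u x ⨯₃ piola ν K w x)
        + ∫ x in K.hex, curl (piola ν K u) x ⬝ᵥ piola ν K w x =
      -flux ν K (primalBdry K) (fun x => piola ν K w x ⨯₃ piola ν K u x)
        + ∫ x in K.hex, curl (piola ν K w) x ⬝ᵥ piola ν K u x := by
  have hanti : ∑ i, ∫ y in Icc (-1) 1, (w (facePoint i (-1) y) ⨯₃ u (facePoint i (-1) y)) i =
      -∑ i, ∫ y in Icc (-1) 1, (u (facePoint i (-1) y) ⨯₃ w (facePoint i (-1) y)) i := by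
    simp only [← cross_anticomm (u _) (w _), Pi.neg_apply, integral_neg, Finset.sum_neg_distrib]
  have hparts := integral_refCube_curl_dotProduct_sub hu hw
  rw [Finset.sum_sub_distrib] at hparts
  rw [flux_dualBdry_space_piola, flux_primalBdry_piola, integral_hex_curl_piola ν K _ hu,
    integral_hex_curl_piola ν K _ hw, hanti]
  linear_combination orientation ν K * hparts

end Integrals

end PiolaTransform

section DiscreteCurl

section Counting

theorem encard_biUnion_le_mul {α β : Type*} {s : Set α} (hs : s.Finite) {f : α → Set β} {c : ℕ∞}
    (hf : ∀ a ∈ s, (f a).encard ≤ c) : (⋃ a ∈ s, f a).encard ≤ s.encard * c := by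
  lift s to Finset α using hs
  rw [encard_coe_eq_coe_finsetCard, ← nsmul_eq_mul]
  exact (s.set_encard_biUnion_le f).trans (Finset.sum_le_card_nsmul _ _ _ hf)

theorem encard_le_of_injOn_prodMk {ι α β : Type*} [Zero β] {t : Finset α} {s : Set ι} {a : ι → α}
    {f : ι → α → β} (ha : ∀ n ∈ s, a n ∈ t) (hf : ∀ n ∈ s, ∀ v ∉ t, f n v = 0)
    (hinj : InjOn (fun n => (a n, f n)) s) :
    s.encard ≤ t.card * ENat.card β ^ t.card := by
  have hmaps : MapsTo (fun n => (a n, fun v : t => f n v)) s ((t : Set α) ×ˢ univ) :=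
    fun n hn => ⟨ha n hn, mem_univ _⟩
  have hinj_restrict : InjOn (fun n => (a n, fun v : t => f n v)) s := by
    intro n hn n' hn' h
    obtain ⟨haa, hff⟩ := Prod.ext_iff.1 h
    refine hinj hn hn' (Prod.ext haa (funext fun v => ?_))
    by_cases hv : v ∈ t
    · exact congrFun hff ⟨v, hv⟩
    · exact (hf n hn v hv).trans (hf n' hn' v hv).symm
  refine (encard_le_encard_of_injOn hmaps hinj_restrict).trans_eq ?_
  rw [encard_prod, encard_coe_eq_coe_finsetCard, encard_univ, ENat.card_fun,
    ENat.card_eq_coe_fintype_card (α := t), Fintype.card_coe,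
    ENat.epow_natCast]

end Counting

variable {S : Geometry.SimplicialComplex ℝ R3} (ν : AxisLabelling S) (K : Subcell S)

theorem Subcell.encard_cell_eq_le {T : Finset R3} (hT : T.card = 4) :
    {K : Subcell S | K.cell = T}.encard ≤ 4 := by
  have hinj : InjOn Subcell.node {K : Subcell S | K.cell = T} := fun K hK K' hK' hnode =>
    Subcell.eq_of_cell_of_node (hK.trans hK'.symm) hnode
  have hmaps : MapsTo Subcell.node {K : Subcell S | K.cell = T} (T : Set R3) := by
    rintro K rfl
    exact K.node_mem
  simpa [encard_coe_eq_coe_finsetCard, hT] using encard_le_encard_of_injOn hmaps hinj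

section BasisFunctions

variable {P : ℕ} (ξ : Fin (P + 1) → ℝ)

theorem contDiff_ell {k : WithTop ℕ∞} (α : Fin 3 → Fin (P + 1)) : ContDiff ℝ k (ell ξ α) :=
  contDiff_prod fun j _ =>
    ((Lagrange.basis Finset.univ ξ (α j)).contDiff_aeval (𝕜 := ℝ) k).comp (contDiff_apply ℝ ℝ j)

theorem piola_zero : piola ν K 0 = 0 :=
  funext fun _ => Matrix.mulVec_zero _

namespace EIndex

/-- The hexahedra that carry `E_n`, which vanishes on all others. -/
def hexes (n : EIndex S P) : Set (Subcell S) :=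
  {K | K.node = n.node ∧ n.simplex ⊆ K.cell}

open Classical in
/-- The degrees of `E_n`, extended by `0` to all points, so that those of two
indices can be compared. -/
def degExt (n : EIndex S P) (v : R3) : Fin (P + 1) :=
  if h : v ∈ n.simplex ∧ v ≠ n.node then n.deg ⟨v, h⟩ else 0

variable {K} {n n' : EIndex S P}

theorem mem_simplex_iff {v : R3} :
    v ∈ n.simplex ↔ v = n.node ∨ v = n.dir ∨ n.degExt v ≠ 0 := by
  constructor
  · intro hv
    by_contra! hne
    have hdeg := hne.2.2
    rw [degExt, dif_pos ⟨hv, hne.1⟩] at hdeg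
    exact n.deg_ne _ hne.2.1 hdeg
  · rintro (rfl | rfl | hdeg)
    · exact n.node_mem
    · exact n.dir_mem
    · by_contra hv
      exact hdeg (dif_neg fun h => hv h.1)

theorem eq_of_degExt_eq (hnode : n.node = n'.node) (hdir : n.dir = n'.dir)
    (hdeg : n.degExt = n'.degExt) : n = n' := by
  have hsimplex : n.simplex = n'.simplex := by
    ext v
    rw [mem_simplex_iff, mem_simplex_iff, hnode, hdir, hdeg]
  obtain ⟨N, F, _, _, w, _, _, a, _⟩ := n
  obtain ⟨N', F', _, _, w', _, _, a', _⟩ := n'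
  dsimp only at hnode hdir hsimplex
  subst hnode hdir hsimplex
  obtain rfl : a = a' := funext fun v => by
    simpa only [degExt, dif_pos v.2] using congrFun hdeg v
  rfl

theorem encard_mem_hexes_le (K : Subcell S) :
    {n : EIndex S P | K ∈ n.hexes}.encard ≤ 3 * ((P : ℕ∞) + 1) ^ 3 := by
  classical
  have hle := encard_le_of_injOn_prodMk (s := {n : EIndex S P | K ∈ n.hexes})
    (t := K.cell.erase K.node) (a := dir) (f := degExt)
    (fun n hn => Finset.mem_erase.2 ⟨hn.1 ▸ n.dir_ne, hn.2 n.dir_mem⟩)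
    (fun n hn v hv => dif_neg fun h => hv (Finset.mem_erase.2 ⟨hn.1 ▸ h.2, hn.2 h.1⟩))
    fun n hn n' hn' h => eq_of_degExt_eq (hn.1.symm.trans hn'.1) (congrArg Prod.fst h)
      (congrArg Prod.snd h)
  simpa [Finset.card_erase_of_mem K.node_mem, K.cell_card] using hle

variable (K) in
theorem contDiff_ref {k : WithTop ℕ∞} (n : EIndex S P) : ContDiff ℝ k (n.ref ν K ξ) := by
  unfold ref
  split_ifs
  · refine contDiff_pi.2 fun i => ?_
    split_ifs
    exacts [contDiff_ell ξ _, contDiff_const]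
  · exact contDiff_const

theorem field_eq_zero (hK : K ∉ n.hexes) : n.field ν K ξ = 0 := by
  have href : n.ref ν K ξ = 0 := funext fun _ => if_neg hK
  rw [field, href, piola_zero]

theorem hex_subset_dualCell_of_field_ne_zero {x : R3} (hx : n.field ν K ξ x ≠ 0) :
    K.hex ⊆ dualCell S n.node := by
  have hK : K ∈ n.hexes := not_imp_comm.1 (field_eq_zero ν ξ) fun h => hx (congrFun h x)
  exact hK.1 ▸ hex_subset_dualCell K

end EIndex

namespace HIndex

/-- The hexahedra that carry `H_ñ`, which vanishes on all others. -/
def hexes (m : HIndex S P) : Set (Subcell S) :=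
  {K | K.cell = m.cell ∧ K.node ∈ m.core}

open Classical in
/-- The degrees of `H_ñ`, extended by `0` to all points, so that those of two
indices can be compared. -/
def degExt (m : HIndex S P) (v : R3) : Fin (P + 1) :=
  if h : v ∈ m.cell ∧ v ∉ m.core then m.deg ⟨v, h⟩ else 0

variable {K} {m m' : HIndex S P}

theorem mem_core_iff {v : R3} :
    v ∈ m.core ↔ v ∈ m.cell ∧ v ≠ m.dir ∧ m.degExt v = 0 := by
  constructor
  · intro hv
    exact ⟨m.core_subset hv, ne_of_mem_of_not_mem hv m.dir_notMem, dif_neg fun h => h.2 hv⟩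
  · rintro ⟨hcell, hdir, hdeg⟩
    by_contra hv
    rw [degExt, dif_pos ⟨hcell, hv⟩] at hdeg
    exact m.deg_ne _ hdir hdeg

theorem eq_of_degExt_eq (hcell : m.cell = m'.cell) (hdir : m.dir = m'.dir)
    (hdeg : m.degExt = m'.degExt) : m = m' := by
  have hcore : m.core = m'.core := by
    ext v
    rw [mem_core_iff, mem_core_iff, hcell, hdir, hdeg]
  obtain ⟨T, _, _, M, _, _, w, _, _, a, _⟩ := m
  obtain ⟨T', _, _, M', _, _, w', _, _, a', _⟩ := m'
  dsimp only at hcell hdir hcore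
  subst hcell hdir hcore
  obtain rfl : a = a' := funext fun v => by
    simpa only [degExt, dif_pos v.2] using congrFun hdeg v
  rfl

theorem encard_mem_hexes_le (K : Subcell S) :
    {m : HIndex S P | K ∈ m.hexes}.encard ≤ 3 * ((P : ℕ∞) + 1) ^ 3 := by
  classical
  have hle := encard_le_of_injOn_prodMk (s := {m : HIndex S P | K ∈ m.hexes})
    (t := K.cell.erase K.node) (a := dir) (f := degExt)
    (fun m hm => Finset.mem_erase.2
      ⟨(ne_of_mem_of_not_mem hm.2 m.dir_notMem).symm, hm.1 ▸ m.dir_mem⟩)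
    (fun m hm v hv => dif_neg fun h => hv (Finset.mem_erase.2
      ⟨(ne_of_mem_of_not_mem hm.2 h.2).symm, hm.1 ▸ h.1⟩))
    fun m hm m' hm' h => eq_of_degExt_eq (hm.1.symm.trans hm'.1) (congrArg Prod.fst h)
      (congrArg Prod.snd h)
  simpa [Finset.card_erase_of_mem K.node_mem, K.cell_card] using hle

variable (K) in
theorem contDiff_ref {k : WithTop ℕ∞} (m : HIndex S P) : ContDiff ℝ k (m.ref ν K ξ) := by
  unfold ref
  split_ifs
  · refine contDiff_pi.2 fun i => ?_
    split_ifs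
    exacts [(contDiff_ell ξ _).comp contDiff_neg, contDiff_const]
  · exact contDiff_const

theorem field_eq_zero (hK : K ∉ m.hexes) : m.field ν K ξ = 0 := by
  have href : m.ref ν K ξ = 0 := funext fun _ => if_neg hK
  rw [field, href, piola_zero]

theorem hex_subset_convexHull_cell_of_field_ne_zero {x : R3} (hx : m.field ν K ξ x ≠ 0) :
    K.hex ⊆ convexHull ℝ (m.cell : Set R3) := by
  have hK : K ∈ m.hexes := not_imp_comm.1 (field_eq_zero ν ξ) fun h => hx (congrFun h x)
  exact hK.1 ▸ hex_subset_convexHull_cell K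

end HIndex

end BasisFunctions

section CurlMatrices

variable {P : ℕ} (ξ : Fin (P + 1) → ℝ)

theorem integrableOn_fluxDensity_field (n : EIndex S P) (m : HIndex S P) (i : Fin 3) {s : ℝ}
    (hs : s ∈ ({-1, 1} : Finset ℝ)) :
    IntegrableOn (fluxDensity ν K (fun x => n.field ν K ξ x ⨯₃ m.field ν K ξ x) i s)
      (Icc (-1) 1) := by
  have hs' : s ∈ Icc (-1 : ℝ) 1 := by
    rcases Finset.mem_insert.1 hs with rfl | hs
    · norm_num
    · norm_num [Finset.mem_singleton.1 hs]
  exact integrableOn_fluxDensity_piola ν K (n.contDiff_ref ν K ξ (k := 0)).continuous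
    (m.contDiff_ref ν K ξ (k := 0)).continuous i hs'

variable [Finite S.faces]

theorem curlE_eq_transpose_curlH {Ω : Set R3} (hΩ : frontier Ω = frontier S.space) :
    curlE ν ξ Ω = (curlH (P := P) ν ξ)ᵀ := by
  ext n m
  simp only [curlE, curlH, dualBdry, hΩ, Matrix.transpose_apply]
  exact Finset.sum_congr rfl fun K _ =>
    neg_flux_add_integral_curl_piola_comm ν K (n.contDiff_ref ν K ξ) (m.contDiff_ref ν K ξ)

variable {m : HIndex S P} {n : EIndex S P}

theorem exists_mem_hexes_of_curlH_ne_zero (h : curlH ν ξ m n ≠ 0) :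
    ∃ K, K ∈ m.hexes ∧ K ∈ n.hexes := by
  by_contra! hK
  refine h (Finset.sum_eq_zero fun K _ => ?_)
  by_cases hm : K ∈ m.hexes
  · simp [n.field_eq_zero ν ξ (hK K hm), flux, fluxDensity]
  · simp [m.field_eq_zero ν ξ hm, flux, fluxDensity, curl]

theorem curlH_eq_zero_of_disjoint
    (h : Disjoint (convexHull ℝ (m.cell : Set R3)) (dualCell S n.node)) : curlH ν ξ m n = 0 := by
  by_contra hne
  obtain ⟨K, hm, hn⟩ := exists_mem_hexes_of_curlH_ne_zero ν ξ hne
  have hmem : trilinear ν K 0 ∈ K.hex :=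
    trilinear_mem_hex ν K (interior_subset zero_mem_interior_refCube)
  exact disjoint_left.1 h (hm.1 ▸ hex_subset_convexHull_cell K hmem)
    (hn.1 ▸ hex_subset_dualCell K hmem)

theorem encard_row_curlH_le (m : HIndex S P) :
    {n | curlH ν ξ m n ≠ 0}.encard ≤ 12 * ((P : ℕ∞) + 1) ^ 3 := by
  have hsub : {n | curlH ν ξ m n ≠ 0} ⊆
      ⋃ K ∈ {K : Subcell S | K.cell = m.cell}, {n : EIndex S P | K ∈ n.hexes} := by
    intro n hn
    obtain ⟨K, hm, hn⟩ := exists_mem_hexes_of_curlH_ne_zero ν ξ hn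
    exact mem_biUnion (x := K) hm.1 hn
  calc {n | curlH ν ξ m n ≠ 0}.encard
      ≤ {K : Subcell S | K.cell = m.cell}.encard * (3 * ((P : ℕ∞) + 1) ^ 3) :=
        (encard_le_encard hsub).trans
          (encard_biUnion_le_mul (toFinite _) fun K _ => EIndex.encard_mem_hexes_le K)
    _ ≤ 4 * (3 * ((P : ℕ∞) + 1) ^ 3) := by
        gcongr
        exact Subcell.encard_cell_eq_le m.cell_card
    _ = 12 * ((P : ℕ∞) + 1) ^ 3 := by
        rw [← mul_assoc]
        norm_num

theorem encard_column_curlH_le (n : EIndex S P) :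
    {m | curlH ν ξ m n ≠ 0}.encard ≤
      3 * ((P : ℕ∞) + 1) ^ 3 * {K : Subcell S | K.node = n.node}.encard := by
  have hsub : {m | curlH ν ξ m n ≠ 0} ⊆
      ⋃ K ∈ {K : Subcell S | K.node = n.node}, {m : HIndex S P | K ∈ m.hexes} := by
    intro m hm
    obtain ⟨K, hm, hn⟩ := exists_mem_hexes_of_curlH_ne_zero ν ξ hm
    exact mem_biUnion (x := K) hn.1 hm
  rw [mul_comm]
  exact (encard_le_encard hsub).trans
    (encard_biUnion_le_mul (toFinite _) fun K _ => HIndex.encard_mem_hexes_le K)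

end CurlMatrices

end DiscreteCurl

end

end DualCell

theorem mainTheorem1_general
    (Ω : Set DualCell.R3)
    (S : Geometry.SimplicialComplex ℝ DualCell.R3) [Finite S.faces]
    (hΩ : frontier Ω = frontier S.space)
    (ν : DualCell.AxisLabelling S)
    (P : ℕ) (ξ : Fin (P + 1) → ℝ) (_hξ : Function.Injective ξ) :
    (∀ (K : DualCell.Subcell S) (n : DualCell.EIndex S P) (m : DualCell.HIndex S P),
      IntegrableOn (fun x => DualCell.curl (n.field ν K ξ) x ⬝ᵥ m.field ν K ξ x) K.hex ∧
      IntegrableOn (fun x => DualCell.curl (m.field ν K ξ) x ⬝ᵥ n.field ν K ξ x) K.hex ∧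
      ∀ (i : Fin 3), ∀ s ∈ ({-1, 1} : Finset ℝ),
        IntegrableOn (DualCell.fluxDensity ν K
          (fun x => n.field ν K ξ x ⨯₃ m.field ν K ξ x) i s) (Icc (-1) 1)) ∧
    DualCell.curlE ν ξ Ω = (DualCell.curlH ν ξ)ᵀ ∧
    (∀ (n : DualCell.EIndex S P) (K : DualCell.Subcell S),
      (∃ x ∈ K.hex, n.field ν K ξ x ≠ 0) → K.hex ⊆ DualCell.dualCell S n.node) ∧
    (∀ (m : DualCell.HIndex S P) (K : DualCell.Subcell S),
      (∃ x ∈ K.hex, m.field ν K ξ x ≠ 0) → K.hex ⊆ convexHull ℝ (m.cell : Set DualCell.R3)) ∧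
    (∀ (m : DualCell.HIndex S P) (n : DualCell.EIndex S P),
      Disjoint (convexHull ℝ (m.cell : Set DualCell.R3)) (DualCell.dualCell S n.node) →
        DualCell.curlH ν ξ m n = 0) ∧
    (∀ m : DualCell.HIndex S P,
      {n | DualCell.curlH ν ξ m n ≠ 0}.encard ≤ 12 * ((P : ℕ∞) + 1) ^ 3) ∧
    (∀ n : DualCell.EIndex S P,
      {m | DualCell.curlH ν ξ m n ≠ 0}.encard ≤
        3 * ((P : ℕ∞) + 1) ^ 3 * {K : DualCell.Subcell S | K.node = n.node}.encard) :=
  ⟨fun K n m =>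
    ⟨DualCell.integrableOn_hex_curl_piola ν K (n.contDiff_ref ν K ξ) (m.contDiff_ref ν K ξ),
      DualCell.integrableOn_hex_curl_piola ν K (m.contDiff_ref ν K ξ) (n.contDiff_ref ν K ξ),
      fun i _ hs => DualCell.integrableOn_fluxDensity_field ν K ξ n m i hs⟩,
    DualCell.curlE_eq_transpose_curlH ν ξ hΩ,
    fun n _ ⟨_, _, hx⟩ => n.hex_subset_dualCell_of_field_ne_zero ν ξ hx,
    fun m _ ⟨_, _, hx⟩ => m.hex_subset_convexHull_cell_of_field_ne_zero ν ξ hx,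
    fun _ _ hdisj => DualCell.curlH_eq_zero_of_disjoint ν ξ hdisj,
    DualCell.encard_row_curlH_le ν ξ,
    DualCell.encard_column_curlH_le ν ξ⟩

theorem mainTheorem1
    (Ω : Set DualCell.R3) (hΩ : IsOpen Ω) (hreg : interior (closure Ω) = Ω)
    (S : Geometry.SimplicialComplex ℝ DualCell.R3) [Finite S.faces] (hcover : S.space = closure Ω)
    (ν : DualCell.AxisLabelling S)
    (P : ℕ) (hP : 0 < P) (ξ : Fin (P + 1) → ℝ) (hξ : DualCell.IsGaussRadau P ξ) :
    -- all integrals that enter the two matrices converge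
    (∀ (K : DualCell.Subcell S) (n : DualCell.EIndex S P) (m : DualCell.HIndex S P),
      IntegrableOn (fun x => DualCell.curl (n.field ν K ξ) x ⬝ᵥ m.field ν K ξ x) K.hex ∧
      IntegrableOn (fun x => DualCell.curl (m.field ν K ξ) x ⬝ᵥ n.field ν K ξ x) K.hex ∧
      ∀ (i : Fin 3), ∀ s ∈ ({-1, 1} : Finset ℝ),
        IntegrableOn (DualCell.fluxDensity ν K
          (fun x => n.field ν K ξ x ⨯₃ m.field ν K ξ x) i s) (Icc (-1) 1)) ∧
    -- the two discrete curl matrices are transposes of each other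
    DualCell.curlE ν ξ Ω = (DualCell.curlH ν ξ)ᵀ ∧
    -- each basis function is supported in a single dual or primal cell
    (∀ (n : DualCell.EIndex S P) (K : DualCell.Subcell S),
      (∃ x ∈ K.hex, n.field ν K ξ x ≠ 0) → K.hex ⊆ DualCell.dualCell S n.node) ∧
    (∀ (m : DualCell.HIndex S P) (K : DualCell.Subcell S),
      (∃ x ∈ K.hex, m.field ν K ξ x ≠ 0) → K.hex ⊆ convexHull ℝ (m.cell : Set DualCell.R3)) ∧
    -- sparsity: entries vanish for disjoint cells, with the resulting row and column counts
    (∀ (m : DualCell.HIndex S P) (n : DualCell.EIndex S P),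
      Disjoint (convexHull ℝ (m.cell : Set DualCell.R3)) (DualCell.dualCell S n.node) →
        DualCell.curlH ν ξ m n = 0) ∧
    (∀ m : DualCell.HIndex S P,
      {n | DualCell.curlH ν ξ m n ≠ 0}.encard ≤ 12 * ((P : ℕ∞) + 1) ^ 3) ∧
    (∀ n : DualCell.EIndex S P,
      {m | DualCell.curlH ν ξ m n ≠ 0}.encard ≤
        3 * ((P : ℕ∞) + 1) ^ 3 * {K : DualCell.Subcell S | K.node = n.node}.encard) :=
  mainTheorem1_general Ω S
    (hcover ▸ (DualCell.frontier_closure_of_interior_closure_eq hreg).symm) ν P ξ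
    hξ.strictMono.injective
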